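/- A partition is a finite (possibly empty) non-increasing sequence of positive integers, and its size is the sum of its parts. For $t\ge 2$, a partition is a \emph{$t$-core} if no hook number of its Ferrers--Young diagram is divisible by $t$, where the hook number of a cell is the number of cells directly to the right of it or directly below it, the cell itself included. Let $A_{t,k}(n)$ be the number of ordered $k$-tuples $(\Lambda_1,\dots,\Lambda_k)$ of $t$-core partitions whose sizes add up to $n$. Then for all integers $n\ge 0$ the following six congruences hold: \begin{align*} A_{5,2}(25n+23)&\equiv 0 \pmod{25},\\ A_{5,2}(125n+123)&\equiv 0 \pmod{125},\\ A_{5,3}(25n+22)&\equiv 0 \pmod{5},\\ A_{5,3}(125n+122)&\equiv 0 \pmod{25},\\ A_{5,4}(25n+21)&\equiv 0 \pmod{3125},\\ A_{5,4}(125n+121)&\equiv 0 \pmod{15625}. \end{align*} -/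

import Mathlib

/-- The hook of the position `c` in the Young (Ferrers) diagram `μ`: the cells of `μ` that lie
directly to the right of `c` or directly below `c`, the cell `c` itself included. -/
def YoungDiagram.hook (μ : YoungDiagram) (c : ℕ × ℕ) : Finset (ℕ × ℕ) :=
  μ.cells.filter fun d => (d.1 = c.1 ∧ c.2 ≤ d.2) ∨ (d.2 = c.2 ∧ c.1 ≤ d.1)

/-- The hook number of the position `c` in `μ`. -/
def YoungDiagram.hookNumber (μ : YoungDiagram) (c : ℕ × ℕ) : ℕ :=
  (μ.hook c).card

/-- A partition, given by its Young diagram, is a `t`-core if no hook number of a cell of its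
diagram is divisible by `t`. -/
def YoungDiagram.IsCore (t : ℕ) (μ : YoungDiagram) : Prop :=
  ∀ c ∈ μ.cells, ¬ t ∣ μ.hookNumber c

/-- The (ordered) `k`-tuples of `t`-core partitions, possibly empty, of total size `n`. -/
def coreTuples (t k n : ℕ) : Set (Fin k → YoungDiagram) :=
  {Λ | (∀ i, (Λ i).IsCore t) ∧ ∑ i, (Λ i).card = n}

/-- `A t k n` is the number of partition `k`-tuples of `n` with `t`-cores. -/
noncomputable def A (t k n : ℕ) : ℕ :=
  (coreTuples t k n).ncard

/-- There are only finitely many Young diagrams with at most `n` cells. -/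
theorem YoungDiagram.finite_card_le (n : ℕ) : {μ : YoungDiagram | μ.card ≤ n}.Finite := by
  have hinj : Function.Injective YoungDiagram.cells := fun _ _ h => YoungDiagram.ext h
  refine Set.Finite.of_finite_image
    (((Finset.range n ×ˢ Finset.range n).powerset.finite_toSet).subset ?_) hinj.injOn
  rintro _ ⟨μ, hμ, rfl⟩
  simp only [Set.mem_setOf_eq] at hμ
  simp only [Finset.coe_powerset, Set.mem_preimage, Set.mem_powerset_iff, Finset.coe_subset]
  rintro ⟨i, j⟩ hc
  have hc' : (i, j) ∈ μ := hc
  have h1 : i + 1 ≤ μ.card := by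
    have := Finset.card_le_card_of_injOn (s := Finset.range (i + 1)) (t := μ.cells)
      (fun a => (a, j))
      (fun a ha => μ.up_left_mem (by simpa [Nat.lt_succ_iff] using ha) le_rfl hc')
      (fun a _ b _ h => (Prod.mk.inj h).1)
    simpa using this
  have h2 : j + 1 ≤ μ.card := by
    have := Finset.card_le_card_of_injOn (s := Finset.range (j + 1)) (t := μ.cells)
      (fun a => (i, a))
      (fun a ha => μ.up_left_mem le_rfl (by simpa [Nat.lt_succ_iff] using ha) hc')
      (fun a _ b _ h => (Prod.mk.inj h).2)
    simpa using this
  simp only [Finset.mem_product, Finset.mem_range]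
  omega

/-- The set counted by `A t k n` is finite. -/
theorem coreTuples_finite (t k n : ℕ) : (coreTuples t k n).Finite := by
  refine (Set.Finite.pi' (fun _ : Fin k => YoungDiagram.finite_card_le n)).subset ?_
  rintro Λ ⟨-, h⟩ i
  rw [Set.mem_setOf_eq, ← h]
  exact Finset.single_le_sum (f := fun i => (Λ i).card) (fun _ _ => Nat.zero_le _)
    (Finset.mem_univ i)

/-! Write `E = ∏ (1 - q^n)` (`pentagonalSeries`). The generating function of 5-cores is `c =
E(q^5)^5 / E(q)` (`coreSeries_mul_pentagonalSeries`), so with `f = q c` the numbers in question are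
coefficients of `f^k` at multiples of 25 or 125. They are read off after applying two or three times
the operator `U = section₅ 0`, which keeps the exponents divisible by 5.

For `k = 2, 3, 4`, `U (f^k)` is an integer combination of `f^k` and products `E(q^5)^a q^s E^b`, and
these products span a space stable under `U`. The congruences are then integer arithmetic with the
resulting small matrices (`dvd_coeff_pow`).

The matrices come from the dissection `E(q) = E(q^25) (x(q^5) - q - q^2 y(q^5))` with `x y = 1`, and
from its norm over the fifth roots of unity, `E^6 = E(q^5)^6 (x^5 - 11 q - q^2 y^5)`. With `z = q
y(q^5)`, powers of `E` and of `f` are, up to series in `q^5`, polynomials in `z`. As `z^5` is a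
series in `q^5`, `U` selects the powers of `z^5`. -/

set_option linter.unusedSimpArgs false

/-! ### The 5-dissection of Euler's product. -/

namespace PowerSeries

/-- The pairs of integers whose generalized pentagonal numbers add up to `n`. -/
noncomputable def pentagonalPairs (n : ℕ) : Finset (ℤ × ℤ) :=
  (Finset.HasAntidiagonal.antidiagonal n).preimage (Prod.map pentagonal pentagonal)
      (pentagonal_injective.prodMap pentagonal_injective).injOn

theorem mem_pentagonalPairs {n : ℕ} {x : ℤ × ℤ} :
    x ∈ pentagonalPairs n ↔ x.1 * (3 * x.1 - 1) + x.2 * (3 * x.2 - 1) = 2 * n := by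
  rw [pentagonalPairs, Finset.mem_preimage, Finset.HasAntidiagonal.mem_antidiagonal,
    Prod.map_fst, Prod.map_snd, ← two_mul_natCast_pentagonal, ← two_mul_natCast_pentagonal]
  omega

theorem sum_antidiagonal_coeff_pentagonalSeries (n : ℕ) (p : ℕ × ℕ → Prop) [DecidablePred p] :
    ∑ x ∈ Finset.HasAntidiagonal.antidiagonal n, (if p x then
      (pentagonalSeries ℤ).coeff x.1 * (pentagonalSeries ℤ).coeff x.2 else 0) =
    ∑ x ∈ (pentagonalPairs n).filter (fun x => p (Prod.map pentagonal pentagonal x)),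
      ((x.1 + x.2).negOnePow : ℤ) := by
  rw [Finset.sum_filter, pentagonalPairs, ← Finset.sum_preimage (Prod.map pentagonal pentagonal)
    _ (pentagonal_injective.prodMap pentagonal_injective).injOn]
  · refine Finset.sum_congr rfl fun x _ => ?_
    split_ifs
    · rw [Prod.map_fst, Prod.map_snd, coeff_pentagonalSeries_pentagonal,
        coeff_pentagonalSeries_pentagonal, Int.negOnePow_add]
      push_cast
      rfl
    · rfl
  · rintro ⟨i, j⟩ _ h
    split_ifs
    · by_cases hi : i ∈ Set.range pentagonal
      · rw [coeff_pentagonalSeries_eq_zero ℤ (n := j), mul_zero]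
        rintro ⟨l, rfl⟩
        obtain ⟨k, rfl⟩ := hi
        exact h ⟨(k, l), rfl⟩
      · rw [coeff_pentagonalSeries_eq_zero ℤ hi, zero_mul]
    · rfl

/-- In the coordinates `6k - 1`, `6l - 1` the condition on pairs fixes a sum of two squares. The
involution is the reflection with matrix `(1/5) [[-3, -4], [-4, 3]]`; the congruence makes it
integral, and it reverses the parity of `k + l`, so the signs cancel. -/
theorem sum_pentagonalPairs_left (n : ℕ) :
    ∑ x ∈ (pentagonalPairs n).filter (fun x => (3 * x.1 + 4 * x.2) % 5 = 2),
      ((x.1 + x.2).negOnePow : ℤ) = 0 := by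
  refine Finset.sum_involution
    (fun x _ => ((2 - 3 * x.1 - 4 * x.2) / 5, (1 - 4 * x.1 + 3 * x.2) / 5)) ?_ ?_ ?_ ?_
  · rintro ⟨k, l⟩ h
    simp only [Finset.mem_filter] at h
    rcases Int.even_or_odd (k + l) with he | he
    · rw [Int.negOnePow_even _ he, Int.negOnePow_odd]
      · simp
      · rw [Int.even_iff] at he
        rw [Int.odd_iff]
        omega
    · rw [Int.negOnePow_odd _ he, Int.negOnePow_even]
      · simp
      · rw [Int.odd_iff] at he
        rw [Int.even_iff]
        omega
  · rintro ⟨k, l⟩ h _ he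
    simp only [Finset.mem_filter, Prod.mk.injEq] at h he
    omega
  · rintro ⟨k, l⟩ h
    simp only [Finset.mem_filter, mem_pentagonalPairs] at h ⊢
    obtain ⟨h1, h2⟩ := h
    obtain ⟨u, hu⟩ : ∃ u, (2 - 3 * k - 4 * l) / 5 = u := ⟨_, rfl⟩
    obtain ⟨v, hv⟩ : ∃ v, (1 - 4 * k + 3 * l) / 5 = v := ⟨_, rfl⟩
    have e1 : 5 * u = 2 - 3 * k - 4 * l := by omega
    have e2 : 5 * v = 1 - 4 * k + 3 * l := by omega
    rw [hu, hv]
    refine ⟨?_, by omega⟩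
    have : 25 * (u * (3 * u - 1) + v * (3 * v - 1)) = 25 * (2 * (n:ℤ)) := by
      rw [← h1]
      linear_combination (15 * u + 3 * (2 - 3 * k - 4 * l) - 5) * e1
        + (15 * v + 3 * (1 - 4 * k + 3 * l) - 5) * e2
    omega
  · rintro ⟨k, l⟩ h
    simp only [Finset.mem_filter] at h
    simp only [Prod.mk.injEq]
    omega

theorem sum_pentagonalPairs_right (n : ℕ) :
    ∑ x ∈ (pentagonalPairs n).filter (fun x => (4 * x.1 + 3 * x.2) % 5 = 2),
      ((x.1 + x.2).negOnePow : ℤ) = 0 := by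
  rw [← sum_pentagonalPairs_left n]
  refine Finset.sum_equiv (Equiv.prodComm ℤ ℤ) ?_ ?_
  · rintro ⟨k, l⟩
    simp only [Finset.mem_filter, mem_pentagonalPairs, Equiv.prodComm_apply, Prod.swap_prod_mk]
    constructor <;> rintro ⟨h1, h2⟩ <;> constructor <;> first | linarith | omega
  · rintro ⟨k, l⟩ _
    simp [add_comm]

theorem pentagonal_mod_five (k : ℤ) : (pentagonal k : ℤ) % 5 =
    if k % 5 = 1 then 1 else if k % 5 = 0 ∨ k % 5 = 2 then 0 else 2 := by
  have h := two_mul_natCast_pentagonal k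
  obtain ⟨m, r, hr, hr', rfl⟩ : ∃ m r : ℤ, 0 ≤ r ∧ r < 5 ∧ k = 5 * m + r :=
    ⟨k / 5, k % 5, by omega, by omega, by omega⟩
  have h2 : 2 * (pentagonal (5 * m + r) : ℤ) =
      5 * (m * (15 * m - 1) + 6 * m * r) + r * (3 * r - 1) := by
    rw [h]; ring
  generalize (m * (15 * m - 1) + 6 * m * r) = t at h2
  have : (5 * m + r) % 5 = r := by omega
  rw [this]
  interval_cases r <;> norm_num at h2 ⊢ <;> omega

/-- The part of the pentagonal series with exponents congruent to `1` modulo `5`. -/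
noncomputable def pentagonalSeriesModOne : ℤ⟦X⟧ :=
  mk fun n => if n % 5 = 1 then (pentagonalSeries ℤ).coeff n else 0

/-- Inclusion-exclusion: for `n ≡ 2 mod 5` every pair satisfies one of the two congruences whose
signed sums vanish, and it satisfies both exactly when `k ≡ l ≡ 1 mod 5`. -/
theorem coeff_pentagonalSeries_sq_add (n : ℕ) (hn : n % 5 = 2) :
    coeff n (pentagonalSeries ℤ * pentagonalSeries ℤ)
      + coeff n (pentagonalSeriesModOne * pentagonalSeriesModOne) = 0 := by
  have h1 : coeff n (pentagonalSeries ℤ * pentagonalSeries ℤ) =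
      ∑ x ∈ pentagonalPairs n, ((x.1 + x.2).negOnePow : ℤ) := by
    have := sum_antidiagonal_coeff_pentagonalSeries n (fun _ => True)
    simpa [coeff_mul] using this
  have h2 : coeff n (pentagonalSeriesModOne * pentagonalSeriesModOne) =
      ∑ x ∈ (pentagonalPairs n).filter (fun x => x.1 % 5 = 1 ∧ x.2 % 5 = 1),
        ((x.1 + x.2).negOnePow : ℤ) := by
    have := sum_antidiagonal_coeff_pentagonalSeries n (fun x => x.1 % 5 = 1 ∧ x.2 % 5 = 1)
    rw [coeff_mul]
    refine Eq.trans (Finset.sum_congr rfl fun x _ => ?_) (this.trans ?_)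
    · simp only [pentagonalSeriesModOne, coeff_mk]
      by_cases a : x.1 % 5 = 1 <;> by_cases b : x.2 % 5 = 1 <;> simp [a, b]
    · refine Finset.sum_congr (Finset.filter_congr fun x _ => ?_) fun _ _ => rfl
      have a := pentagonal_mod_five x.1
      have b := pentagonal_mod_five x.2
      simp only [Prod.map_fst, Prod.map_snd]
      split_ifs at a b <;> omega
  have h3 := sum_pentagonalPairs_left n
  have h4 := sum_pentagonalPairs_right n
  rw [h1, h2]
  rw [Finset.sum_filter] at h3 h4 ⊢
  refine Eq.trans ?_ ((congrArg₂ (· + ·) h3 h4).trans (add_zero 0))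
  rw [← Finset.sum_add_distrib, ← Finset.sum_add_distrib]
  refine Finset.sum_congr rfl fun x hx => ?_
  have hx' : (pentagonal x.1 : ℤ) + pentagonal x.2 = n := by
    have := mem_pentagonalPairs.1 hx
    rw [← two_mul_natCast_pentagonal, ← two_mul_natCast_pentagonal] at this
    omega
  have a := pentagonal_mod_five x.1
  have b := pentagonal_mod_five x.2
  have key : (3 * x.1 + 4 * x.2) % 5 = 2 ∧ (4 * x.1 + 3 * x.2) % 5 = 2 ∧
      (x.1 % 5 = 1 ∧ x.2 % 5 = 1) ∨ (3 * x.1 + 4 * x.2) % 5 = 2 ∧ ¬ (4 * x.1 + 3 * x.2) % 5 = 2 ∧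
      ¬ (x.1 % 5 = 1 ∧ x.2 % 5 = 1) ∨ ¬ (3 * x.1 + 4 * x.2) % 5 = 2 ∧
      (4 * x.1 + 3 * x.2) % 5 = 2 ∧ ¬ (x.1 % 5 = 1 ∧ x.2 % 5 = 1) := by
    have hk : x.1 % 5 = 0 ∨ x.1 % 5 = 1 ∨ x.1 % 5 = 2 ∨ x.1 % 5 = 3 ∨ x.1 % 5 = 4 := by omega
    have hl : x.2 % 5 = 0 ∨ x.2 % 5 = 1 ∨ x.2 % 5 = 2 ∨ x.2 % 5 = 3 ∨ x.2 % 5 = 4 := by omega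
    rcases hk with hk | hk | hk | hk | hk <;> rcases hl with hl | hl | hl | hl | hl <;>
      simp only [hk, hl] at a b <;> norm_num at a b <;> omega
  rcases key with ⟨k1, k2, k3⟩ | ⟨k1, k2, k3⟩ | ⟨k1, k2, k3⟩
  · rw [if_pos k1, if_pos k2, if_pos k3]
  · rw [if_pos k1, if_neg k2, if_neg k3]
  · rw [if_neg k1, if_pos k2, if_neg k3, add_comm]

/-- The indices involved are `k = 1 - 5m`, whose pentagonal number is 25 times that of `m`, plus 1;
the parity changes, whence the minus sign. -/
theorem pentagonalSeriesModOne_eq : pentagonalSeriesModOne =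
    -(X * expand 5 (by norm_num) (expand 5 (by norm_num) (pentagonalSeries ℤ))) := by
  have hshift : ∀ k : ℤ, pentagonal (1 - 5 * k) = 25 * pentagonal k + 1 := by
    intro k
    have h1 := two_mul_natCast_pentagonal (1 - 5 * k)
    have h2 := two_mul_natCast_pentagonal k
    have : 2 * (pentagonal (1 - 5 * k) : ℤ) = 2 * (25 * pentagonal k + 1) := by
      linear_combination h1 - 25 * h2
    omega
  rw [← expand_mul]
  ext n
  rw [pentagonalSeriesModOne, coeff_mk, map_neg]
  rcases n with _ | n
  · simp
  rw [coeff_succ_X_mul, coeff_expand]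
  by_cases hn : n + 1 ∈ Set.range pentagonal
  · obtain ⟨k, hk⟩ := hn
    have a := pentagonal_mod_five k
    rw [hk] at a
    by_cases h5 : k % 5 = 1
    · rw [if_pos h5] at a
      obtain ⟨m, rfl⟩ : ∃ m, k = 1 - 5 * m := ⟨(1 - k) / 5, by omega⟩
      have := hshift m
      have hn : n = 25 * pentagonal m := by omega
      have hd : n / (5 * 5) = pentagonal m := by omega
      rw [if_pos (by omega), if_pos (by omega), ← hk, coeff_pentagonalSeries_pentagonal, hd,
        coeff_pentagonalSeries_pentagonal]
      rcases Int.even_or_odd m with he | he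
      · rw [Int.negOnePow_even _ he, Int.negOnePow_odd]
        · simp
        · rw [Int.even_iff] at he
          rw [Int.odd_iff]
          omega
      · rw [Int.negOnePow_odd _ he, Int.negOnePow_even]
        · simp
        · rw [Int.odd_iff] at he
          rw [Int.even_iff]
          omega
    · have : ¬ (n + 1) % 5 = 1 := by
        split_ifs at a <;> omega
      rw [if_neg this, if_neg (by omega), neg_zero]
  · rw [coeff_pentagonalSeries_eq_zero ℤ hn, ite_self]
    split_ifs with hd
    · rw [coeff_pentagonalSeries_eq_zero, neg_zero]
      rintro ⟨m, hm⟩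
      refine hn ⟨1 - 5 * m, ?_⟩
      rw [hshift, hm]
      omega
    · simp

theorem coeff_pentagonalSeries_eq_zero_of_mod {n : ℕ} (h : n % 5 = 3 ∨ n % 5 = 4) :
    (pentagonalSeries ℤ).coeff n = 0 := by
  refine coeff_pentagonalSeries_eq_zero ℤ ?_
  rintro ⟨k, rfl⟩
  have a := pentagonal_mod_five k
  split_ifs at a <;> omega

/-- The coefficients of a power series along the residue class of `j` modulo `5`. -/
noncomputable def section₅ (j : ℕ) : ℤ⟦X⟧ →+ ℤ⟦X⟧ where
  toFun f := mk fun n => coeff (5 * n + j) f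
  map_zero' := by ext; simp
  map_add' f g := by ext; simp

/-- The substitution of the fifth power of the variable. -/
noncomputable abbrev dilate₅ : ℤ⟦X⟧ →ₐ[ℤ] ℤ⟦X⟧ := expand 5 (by norm_num)

@[simp]
theorem coeff_section₅ (j n : ℕ) (f : ℤ⟦X⟧) : coeff n (section₅ j f) = coeff (5 * n + j) f :=
  coeff_mk n fun n => coeff (5 * n + j) f

theorem section₅_X_pow_mul_dilate₅ {i j : ℕ} (hi : i < 5) (hj : j < 5) (f : ℤ⟦X⟧) :
    section₅ i (X ^ j * dilate₅ f) = if i = j then f else 0 := by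
  ext n
  rw [coeff_section₅, coeff_X_pow_mul', coeff_expand]
  split_ifs with h1 h2 h3 h3 h3
  all_goals first | omega | rfl | (congr 2; omega)

theorem section₅_sum {i : ℕ} (hi : i < 5) (f : ℕ → ℤ⟦X⟧) :
    section₅ i (∑ j ∈ Finset.range 5, X ^ j * dilate₅ (f j)) = f i := by
  rw [map_sum, Finset.sum_eq_single i]
  · rw [section₅_X_pow_mul_dilate₅ hi hi, if_pos rfl]
  · intro j hj hij
    rw [section₅_X_pow_mul_dilate₅ hi (Finset.mem_range.1 hj), if_neg hij.symm]
  · intro h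
    exact absurd (Finset.mem_range.2 hi) h

theorem section₅_sum_eq {i : ℕ} (hi : i < 5) (a b c d e : ℤ⟦X⟧) :
    section₅ i (dilate₅ a + X * dilate₅ b + X ^ 2 * dilate₅ c + X ^ 3 * dilate₅ d
      + X ^ 4 * dilate₅ e) = [a, b, c, d, e].getD i 0 := by
  rw [← section₅_sum hi fun j => [a, b, c, d, e].getD j 0]
  simp [Finset.sum_range_succ]

theorem dilate₅_injective : Function.Injective dilate₅ := by
  intro f g h
  have h' := congrArg (section₅ 0) h
  have h1 := section₅_X_pow_mul_dilate₅ (i := 0) (j := 0) (by norm_num) (by norm_num)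
  simp only [pow_zero, one_mul, if_true] at h1
  rwa [h1, h1] at h'

theorem pentagonalSeries_eq_sections : pentagonalSeries ℤ =
    dilate₅ (section₅ 0 (pentagonalSeries ℤ)) + pentagonalSeriesModOne
      + X ^ 2 * dilate₅ (section₅ 2 (pentagonalSeries ℤ)) := by
  ext n
  rw [map_add, map_add, coeff_X_pow_mul', coeff_expand, coeff_expand, pentagonalSeriesModOne,
    coeff_mk, coeff_section₅, coeff_section₅]
  have : n % 5 < 5 := Nat.mod_lt _ (by norm_num)
  obtain h | h | h | h : n % 5 = 0 ∨ n % 5 = 1 ∨ n % 5 = 2 ∨ (n % 5 = 3 ∨ n % 5 = 4) := by omega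
  · rw [if_pos (by omega), if_neg (by omega)]
    have : 5 * (n / 5) + 0 = n := by omega
    rw [this]
    split_ifs <;> omega
  · rw [if_neg (by omega), if_pos h]
    split_ifs <;> omega
  · rw [if_neg (by omega), if_neg (by omega), if_pos (by omega), if_pos (by omega)]
    have : 5 * ((n - 2) / 5) + 2 = n := by omega
    rw [this]
    simp
  · rw [if_neg (by omega), if_neg (by omega), coeff_pentagonalSeries_eq_zero_of_mod h]
    split_ifs <;> omega

/-- With `a`, `c` the sections and `F = E(q^5)`, section 2 of `E^2` is `2ac + F^2` and that of the
squared middle term is `F^2`. Their sum vanishes, so `2 (ac + F^2) = 0`. -/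
theorem section₅_pentagonalSeries_mul :
    section₅ 0 (pentagonalSeries ℤ) * section₅ 2 (pentagonalSeries ℤ) =
      -dilate₅ (pentagonalSeries ℤ) ^ 2 := by
  set E := pentagonalSeries ℤ with hE
  set a := section₅ 0 E
  set c := section₅ 2 E
  have hB : pentagonalSeriesModOne = -(X * dilate₅ (dilate₅ E)) := pentagonalSeriesModOne_eq
  have h1 : E * E + pentagonalSeriesModOne * pentagonalSeriesModOne =
      dilate₅ (a ^ 2) + X * dilate₅ (-2 * a * dilate₅ E) +
        X ^ 2 * dilate₅ (2 * (a * c + dilate₅ E ^ 2)) +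
        X ^ 3 * dilate₅ (-2 * c * dilate₅ E) + X ^ 4 * dilate₅ (c ^ 2) := by
    have hS : E = dilate₅ a + pentagonalSeriesModOne + X ^ 2 * dilate₅ c :=
      pentagonalSeries_eq_sections
    rw [hB] at hS ⊢
    generalize dilate₅ E = F at *
    generalize a = a at *
    generalize c = c at *
    rw [hS]
    simp only [map_mul, map_add, map_pow, map_neg, map_ofNat]
    ring
  have h2 := congrArg (section₅ 2) h1
  rw [section₅_sum_eq (by norm_num)] at h2
  have h3 : section₅ 2 (E * E + pentagonalSeriesModOne * pentagonalSeriesModOne) = 0 := by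
    ext n
    rw [coeff_section₅, map_add, hE, coeff_pentagonalSeries_sq_add _ (by omega), map_zero]
  rw [h3] at h2
  simp only [List.getD_cons_succ, List.getD_cons_zero] at h2
  have h2' : (2 : ℤ⟦X⟧) ≠ 0 := fun h => by
    have := congrArg constantCoeff h
    rw [map_ofNat, map_zero] at this
    norm_num at this
  have h4 := (mul_eq_zero.1 h2.symm).resolve_left h2'
  linear_combination h4

theorem isUnit_pentagonalSeries : IsUnit (pentagonalSeries ℤ) := by
  rw [isUnit_iff_constantCoeff, ← coeff_zero_eq_constantCoeff_apply]
  have := coeff_pentagonalSeries_pentagonal ℤ 0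
  simp only [pentagonal_def] at this
  norm_num at this
  simp [this]

/-- The `5`-dissection of the pentagonal series. -/
theorem exists_pentagonalSeries_dissection : ∃ x y : ℤ⟦X⟧, x * y = 1 ∧
    pentagonalSeries ℤ = dilate₅ (dilate₅ (pentagonalSeries ℤ)) *
      (dilate₅ x - X - X ^ 2 * dilate₅ y) := by
  have hac := section₅_pentagonalSeries_mul
  have hE := pentagonalSeries_eq_sections
  rw [show pentagonalSeriesModOne = -(X * dilate₅ (dilate₅ (pentagonalSeries ℤ))) from
    pentagonalSeriesModOne_eq] at hE
  generalize section₅ 0 (pentagonalSeries ℤ) = a at *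
  generalize section₅ 2 (pentagonalSeries ℤ) = c at *
  obtain ⟨w, hw⟩ := (isUnit_pentagonalSeries.map dilate₅).exists_right_inv
  have hw' := congrArg dilate₅ hw
  rw [map_mul, map_one] at hw'
  -- Here `w = 1 / E(q^5)`, so `x y = -a c / E(q^5)^2 = 1`.
  refine ⟨a * w, -(c * w), ?_, ?_⟩
  · linear_combination -w ^ 2 * hac +
      (1 + dilate₅ (pentagonalSeries ℤ) * w) * hw
  · conv_lhs => rw [hE]
    simp only [map_mul, map_neg]
    linear_combination (-dilate₅ a - X ^ 2 * dilate₅ c) * hw'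

/-! ### The norm over the fifth roots of unity. -/

theorem prod_one_sub_pow_mul {R : Type*} [CommRing R] {w : R}
    (hw : ∑ i ∈ Finset.range 5, w ^ i = 0) (y : R) :
    ∏ i ∈ Finset.range 5, (1 - w ^ i * y) = 1 - y ^ 5 := by
  simp only [Finset.sum_range_succ, Finset.prod_range_succ, Finset.range_zero,
    Finset.sum_empty, Finset.prod_empty] at hw ⊢
  linear_combination (-y + y ^ 5 + w * y ^ 2 - w * y ^ 5 + w ^ 3 * y ^ 2 - w ^ 3 * y ^ 3
    - w ^ 5 * y ^ 3 + w ^ 5 * y ^ 5 + w ^ 6 * y ^ 4 - w ^ 6 * y ^ 5) * hw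

open WithPiTopology in
theorem continuous_rescale {R : Type*} [CommRing R] [TopologicalSpace R] [IsTopologicalRing R]
    (a : R) : Continuous (rescale a : R⟦X⟧ →+* R⟦X⟧) := by
  refine continuous_iff_continuousAt.2 fun f => ?_
  rw [ContinuousAt, tendsto_iff_coeff_tendsto]
  intro d
  simp only [coeff_rescale]
  exact ((continuous_const.mul (continuous_coeff R d)).tendsto f)

open WithPiTopology in
theorem continuous_expand {R : Type*} [CommRing R] [TopologicalSpace R] (p : ℕ) (hp : p ≠ 0) :
    Continuous (expand p hp : R⟦X⟧ →ₐ[R] R⟦X⟧) := by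
  refine continuous_iff_continuousAt.2 fun f => ?_
  rw [ContinuousAt, tendsto_iff_coeff_tendsto]
  intro d
  simp only [coeff_expand]
  split_ifs
  · exact (continuous_coeff R _).tendsto f
  · exact tendsto_const_nhds

theorem rescale_expand {R : Type*} [CommRing R] {a : R} {p : ℕ} (hp : p ≠ 0) (ha : a ^ p = 1)
    (f : R⟦X⟧) : rescale a (expand p hp f) = expand p hp f := by
  ext n
  rw [coeff_rescale, coeff_expand]
  split_ifs with h
  · obtain ⟨m, rfl⟩ := h
    rw [pow_mul, ha, one_pow, one_mul]
  · rw [mul_zero]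

open WithPiTopology in
/-- The product of the conjugates of the Euler product under the fifth roots of unity. -/
theorem prod_rescale_pentagonalSeries {ζ : ℂ} (hζ : IsPrimitiveRoot ζ 5) :
    (∏ i ∈ Finset.range 5, rescale (ζ ^ i) (pentagonalSeries ℂ)) *
      expand 5 (by norm_num) (expand 5 (by norm_num) (pentagonalSeries ℂ)) =
    expand 5 (by norm_num) (pentagonalSeries ℂ) ^ 6 := by
  have h50 : 5 ≠ 0 := by norm_num
  have hE := hasProd_one_sub_X_pow ℂ
  have h1 : HasProd (fun n => ∏ i ∈ Finset.range 5, (1 - C (ζ ^ (i * (n + 1))) * X ^ (n + 1)))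
      (∏ i ∈ Finset.range 5, rescale (ζ ^ i) (pentagonalSeries ℂ)) := by
    refine hasProd_prod fun i _ => ?_
    convert hE.map (rescale (ζ ^ i)) (continuous_rescale _) using 2 with n
    simp only [Function.comp_apply, map_sub, map_one, map_pow, rescale_X, mul_pow, ← pow_mul]
  -- The factor of index `n` is `1 - X ^ (n + 1)`, so the exponents divisible by 5 sit at `n = 5m +
  -- 4`.
  have hinj : Function.Injective fun m : ℕ => 5 * m + 4 := fun a b h => by
    simp only at h; omega
  have h2 : HasProd (fun n => if 5 ∣ n + 1 then (1 - X ^ (5 * (n + 1)) : ℂ⟦X⟧) else 1)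
      (expand 5 h50 (expand 5 h50 (pentagonalSeries ℂ))) := by
    refine (hinj.hasProd_iff ?_).1 ?_
    · intro n hn
      rw [if_neg]
      rintro ⟨m, hm⟩
      exact hn ⟨m - 1, by simp only; omega⟩
    · convert (hE.map (expand 5 h50) (continuous_expand 5 h50)).map
        (expand 5 h50) (continuous_expand 5 h50) using 1
      funext n
      have : 5 * n + 4 + 1 = 5 * (n + 1) := by ring
      simp only [Function.comp_apply, map_sub, map_one, map_pow, expand_X, this, dvd_mul_right,
        if_true, ← pow_mul]
  have h3 : HasProd (fun n => if 5 ∣ n + 1 then (1 - X ^ (n + 1) : ℂ⟦X⟧) else 1)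
      (expand 5 h50 (pentagonalSeries ℂ)) := by
    refine (hinj.hasProd_iff ?_).1 ?_
    · intro n hn
      rw [if_neg]
      rintro ⟨m, hm⟩
      exact hn ⟨m - 1, by simp only; omega⟩
    · convert hE.map (expand 5 h50) (continuous_expand 5 h50) using 1
      funext n
      have : 5 * n + 4 + 1 = 5 * (n + 1) := by ring
      simp only [Function.comp_apply, map_sub, map_one, map_pow, expand_X, this, dvd_mul_right,
        if_true, ← pow_mul]
  have h4 : HasProd (fun n => (1 - X ^ (5 * (n + 1)) : ℂ⟦X⟧))
      (expand 5 h50 (pentagonalSeries ℂ)) := by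
    convert hE.map (expand 5 h50) (continuous_expand 5 h50) using 2 with n
    simp only [Function.comp_apply, map_sub, map_one, map_pow, expand_X, ← pow_mul]
  have h5 := h4.mul (hasProd_prod (s := Finset.range 5) fun i _ => h3)
  have h6 := h1.mul h2
  rw [Finset.prod_const, Finset.card_range, ← pow_succ'] at h5
  refine h6.unique ?_
  convert h5 using 2 with n
  rw [Finset.prod_const, Finset.card_range]
  -- A factor in `q^5` equals its five conjugates and contributes a fifth power; any other has norm
  -- `1 - X ^ (5 * (n + 1))`.
  by_cases hn : 5 ∣ n + 1
  · simp only [if_pos hn]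
    rw [mul_comm, Finset.prod_congr rfl fun i _ => ?_, Finset.prod_const, Finset.card_range]
    obtain ⟨m, hm⟩ := hn
    rw [hm, show i * (5 * m) = 5 * (i * m) by ring, pow_mul, hζ.pow_eq_one, one_pow, map_one,
      one_mul]
  · simp only [if_neg hn, mul_one, one_pow]
    have hζ' : IsPrimitiveRoot (ζ ^ (n + 1)) 5 :=
      hζ.pow_of_coprime _ ((Nat.Prime.coprime_iff_not_dvd (by norm_num)).2 hn).symm
    have h0 : ∑ i ∈ Finset.range 5, (C (ζ ^ (n + 1)) : ℂ⟦X⟧) ^ i = 0 := by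
      have := congrArg (C : ℂ →+* ℂ⟦X⟧) (hζ'.geom_sum_eq_zero (by norm_num))
      simpa using this
    have := prod_one_sub_pow_mul h0 (X ^ (n + 1))
    rw [← pow_mul, mul_comm (n + 1)] at this
    rw [← this]
    refine Finset.prod_congr rfl fun i _ => ?_
    rw [← map_pow, ← pow_mul, mul_comm i]

/-- Factor `1 - z - z^2 = (1 - az)(1 - bz)` with `a`, `b` the golden ratio and its conjugate. The
norm replaces each root by its fifth power, and 11 is the Lucas number `a^5 + b^5`. -/
theorem prod_one_sub_sub_sq {ζ : ℂ} (hζ : IsPrimitiveRoot ζ 5) (z : ℂ⟦X⟧) :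
    ∏ i ∈ Finset.range 5, (1 - C (ζ ^ i) * z - (C (ζ ^ i) * z) ^ 2) =
      1 - 11 * z ^ 5 - z ^ 10 := by
  have h0 : ∑ i ∈ Finset.range 5, (C ζ : ℂ⟦X⟧) ^ i = 0 := by
    have := congrArg (C : ℂ →+* ℂ⟦X⟧) (hζ.geom_sum_eq_zero (by norm_num))
    simpa using this
  obtain ⟨a, b, hs, hp⟩ : ∃ a b : ℂ⟦X⟧, a + b = 1 ∧ a * b = -1 := by
    refine ⟨C (Real.goldenRatio : ℂ), C (Real.goldenConj : ℂ), ?_, ?_⟩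
    · rw [← map_add, ← Complex.ofReal_add, Real.goldenRatio_add_goldenConj, Complex.ofReal_one,
        map_one]
    · rw [← map_mul, ← Complex.ofReal_mul, Real.goldenRatio_mul_goldenConj, Complex.ofReal_neg,
        Complex.ofReal_one, map_neg, map_one]
  obtain rfl : b = 1 - a := by linear_combination hs
  have ha : a ^ 2 = a + 1 := by linear_combination -hp
  have h1 := prod_one_sub_pow_mul h0 (a * z)
  have h2 := prod_one_sub_pow_mul h0 ((1 - a) * z)
  calc _ = ∏ i ∈ Finset.range 5, ((1 - C ζ ^ i * (a * z)) * (1 - C ζ ^ i * ((1 - a) * z))) := by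
        refine Finset.prod_congr rfl fun i _ => ?_
        rw [map_pow]
        linear_combination -(C ζ ^ i * z) ^ 2 * hp
    _ = (1 - (a * z) ^ 5) * (1 - ((1 - a) * z) ^ 5) := by
        rw [Finset.prod_mul_distrib, h1, h2]
    _ = _ := by
        have h3 : a ^ 5 + (1 - a) ^ 5 = 11 := by
          linear_combination (5 * a ^ 2 - 5 * a + 10) * ha
        have h4 : (a * (1 - a)) ^ 5 = -1 := by rw [hp]; norm_num
        linear_combination -z ^ 5 * h3 + z ^ 10 * h4

theorem map_pentagonalSeries : map (Int.castRingHom ℂ) (pentagonalSeries ℤ) =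
    pentagonalSeries ℂ := by
  ext n
  rw [coeff_map]
  by_cases hn : n ∈ Set.range pentagonal
  · obtain ⟨k, rfl⟩ := hn
    rw [coeff_pentagonalSeries_pentagonal, coeff_pentagonalSeries_pentagonal]
    simp
  · rw [coeff_pentagonalSeries_eq_zero _ hn, coeff_pentagonalSeries_eq_zero _ hn, map_zero]

/-- The relation satisfied by the two series of the `5`-dissection of the pentagonal series. -/
theorem pentagonalSeries_pow_six {x y : ℤ⟦X⟧} (hxy : x * y = 1)
    (h : pentagonalSeries ℤ = dilate₅ (dilate₅ (pentagonalSeries ℤ)) *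
      (dilate₅ x - X - X ^ 2 * dilate₅ y)) :
    pentagonalSeries ℤ ^ 6 = dilate₅ (pentagonalSeries ℤ) ^ 6 *
      (x ^ 5 - 11 * X - X ^ 2 * y ^ 5) := by
  -- The norm lives over `ℂ` and yields the identity at `q^5`; both passages are injective.
  refine dilate₅_injective (map_injective (Int.castRingHom ℂ) Int.cast_injective ?_)
  obtain ⟨ζ, hζ⟩ : ∃ ζ : ℂ, IsPrimitiveRoot ζ 5 := ⟨_, Complex.isPrimitiveRoot_exp 5 (by norm_num)⟩
  have hprod := prod_rescale_pentagonalSeries hζ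
  have h' := congrArg (map (Int.castRingHom ℂ)) h
  have hxy' := congrArg (fun f => map (Int.castRingHom ℂ) (dilate₅ f)) hxy
  simp only [map_mul, map_sub, map_pow, map_X, map_expand, map_pentagonalSeries, map_one,
    expand_X, map_ofNat] at h' hxy' ⊢
  set E := pentagonalSeries ℂ
  set x' := map (Int.castRingHom ℂ) x
  set y' := map (Int.castRingHom ℂ) y
  have hr : ∀ i ∈ Finset.range 5, rescale (ζ ^ i) E = expand 5 (by norm_num)
      (expand 5 (by norm_num) E * x') * (1 - C (ζ ^ i) * (X * expand 5 (by norm_num) y')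
        - (C (ζ ^ i) * (X * expand 5 (by norm_num) y')) ^ 2) := by
    intro i _
    have hi : (ζ ^ i) ^ 5 = 1 := by rw [← pow_mul, mul_comm, pow_mul, hζ.pow_eq_one, one_pow]
    conv_lhs => rw [h']
    simp only [map_mul, map_sub, map_pow, rescale_X, rescale_expand _ hi]
    linear_combination (expand 5 _ (expand 5 _ E)) * (C ζ ^ i * X +
      (C ζ ^ i) ^ 2 * X ^ 2 * expand 5 _ y') * hxy'
  rw [Finset.prod_congr rfl hr, Finset.prod_mul_distrib, prod_one_sub_sub_sq hζ,
    Finset.prod_const, Finset.card_range] at hprod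
  rw [← hprod]
  simp only [map_mul]
  have h5 : expand 5 (by norm_num) x' ^ 5 * expand 5 (by norm_num) y' ^ 5 = 1 := by
    rw [← mul_pow, hxy', one_pow]
  generalize expand 5 _ x' = x'' at *
  generalize expand 5 _ y' = y'' at *
  generalize expand 5 _ (expand 5 _ E) = F at *
  linear_combination F ^ 6 * (-11 * X ^ 5 - X ^ 10 * y'' ^ 5) * h5

end PowerSeries

/-! ### Polynomial dissections modulo 5. -/

namespace Polynomial

/-- The cofactor of `1 - X - X ^ 2` in its norm with respect to the fifth roots of unity. -/
noncomputable def dissectionCofactor : ℤ[X] :=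
  1 + X + 2 * X ^ 2 + 3 * X ^ 3 + 5 * X ^ 4 - 3 * X ^ 5 + 2 * X ^ 6 - X ^ 7 + X ^ 8

theorem mul_dissectionCofactor :
    (1 - X - X ^ 2) * dissectionCofactor = 1 - 11 * X ^ 5 - X ^ 10 := by
  rw [dissectionCofactor]
  ring

/-- In all these dissections only the first component is used later, for `section₅ 0`; the other
four complete the identity. -/
theorem expand_five_X_mul_pow_four : (X ^ 1 * (1 - X - X ^ 2) ^ 4 : ℤ[X]) =
    expand ℤ 5 (-5 * X) +
    X * expand ℤ 5 (1 - 8 * X) +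
    X ^ 2 * expand ℤ 5 (-4 + 2 * X) +
    X ^ 3 * expand ℤ 5 (2 + 4 * X) +
    X ^ 4 * expand ℤ 5 (8 + X) := by
  simp only [map_add, map_sub, map_mul, map_pow, map_neg, map_one, map_zero, map_ofNat, expand_X]
  ring

theorem expand_five_X_sq_mul_pow_three : (X ^ 2 * (1 - X - X ^ 2) ^ 3 : ℤ[X]) =
    expand ℤ 5 (5 * X) +
    X * expand ℤ 5 (0) +
    X ^ 2 * expand ℤ 5 (1 - 3 * X) +
    X ^ 3 * expand ℤ 5 (-3 - X) +
    X ^ 4 * expand ℤ 5 (0) := by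
  simp only [map_add, map_sub, map_mul, map_pow, map_neg, map_one, map_zero, map_ofNat, expand_X]
  ring

theorem expand_five_X_pow_three_mul_sq : (X ^ 3 * (1 - X - X ^ 2) ^ 2 : ℤ[X]) =
    expand ℤ 5 (-X) +
    X * expand ℤ 5 (2 * X) +
    X ^ 2 * expand ℤ 5 (X) +
    X ^ 3 * expand ℤ 5 (1) +
    X ^ 4 * expand ℤ 5 (-2) := by
  simp only [map_add, map_sub, map_mul, map_pow, map_neg, map_one, map_zero, map_ofNat, expand_X]
  ring

theorem expand_five_X_sq_mul_pow_eight : (X ^ 2 * (1 - X - X ^ 2) ^ 8 : ℤ[X]) =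
    expand ℤ 5 (-125 * X ^ 2) +
    X * expand ℤ 5 (-70 * X + 120 * X ^ 2 + 20 * X ^ 3) +
    X ^ 2 * expand ℤ 5 (1 + 56 * X + 112 * X ^ 2 + 8 * X ^ 3) +
    X ^ 3 * expand ℤ 5 (-8 + 112 * X - 56 * X ^ 2 + X ^ 3) +
    X ^ 4 * expand ℤ 5 (20 - 120 * X - 70 * X ^ 2) := by
  simp only [map_add, map_sub, map_mul, map_pow, map_neg, map_one, map_zero, map_ofNat, expand_X]
  ring

theorem expand_five_X_mul_pow_fourteen : (X ^ 1 * (1 - X - X ^ 2) ^ 14 : ℤ[X]) =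
    expand ℤ 5 (-15625 * X ^ 3) +
    X * expand ℤ 5 (1 + 910 * X - 10010 * X ^ 2 + 6930 * X ^ 3 + 5005 * X ^ 4 + 182 * X ^ 5) +
    X ^ 2 * expand ℤ 5 (-14 - 1365 * X + 3640 * X ^ 2 + 14105 * X ^ 3 + 1430 * X ^ 4 +
      77 * X ^ 5) +
    X ^ 3 * expand ℤ 5 (77 - 1430 * X + 14105 * X ^ 2 - 3640 * X ^ 3 - 1365 * X ^ 4 +
      14 * X ^ 5) +
    X ^ 4 * expand ℤ 5 (-182 + 5005 * X - 6930 * X ^ 2 - 10010 * X ^ 3 - 910 * X ^ 4 +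
      X ^ 5) := by
  simp only [map_add, map_sub, map_mul, map_pow, map_neg, map_one, map_zero, map_ofNat, expand_X]
  ring

/-- Here the first component is not a monomial: it is `-90 X P - 625 X^2` with `P = 1 - 11 X - X^2`.
-/
theorem expand_five_X_mul_pow_nine : (X ^ 1 * (1 - X - X ^ 2) ^ 9 : ℤ[X]) =
    expand ℤ 5 (-90 * X + 365 * X ^ 2 + 90 * X ^ 3) +
    X * expand ℤ 5 (1 + 126 * X + 117 * X ^ 2 - 12 * X ^ 3) +
    X ^ 2 * expand ℤ 5 (-9 + 126 * X - 288 * X ^ 2 - 27 * X ^ 3) +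
    X ^ 3 * expand ℤ 5 (27 - 288 * X - 126 * X ^ 2 - 9 * X ^ 3) +
    X ^ 4 * expand ℤ 5 (-12 - 117 * X + 126 * X ^ 2 - X ^ 3) := by
  simp only [map_add, map_sub, map_mul, map_pow, map_neg, map_one, map_zero, map_ofNat, expand_X]
  ring

/-- The first components of the cofactor powers are forms in `X` and `P = 1 - 11 X - X^2`; here it
is `125 X^2 + 10 X P`. -/
theorem expand_five_cofactor_pow_two : ((X * dissectionCofactor) ^ 2 : ℤ[X]) =
    expand ℤ 5 (10 * X + 15 * X ^ 2 - 10 * X ^ 3) +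
    X * expand ℤ 5 (20 * X - 20 * X ^ 2 + 5 * X ^ 3) +
    X ^ 2 * expand ℤ 5 (1 + 16 * X + 27 * X ^ 2 - 2 * X ^ 3) +
    X ^ 3 * expand ℤ 5 (2 + 27 * X - 16 * X ^ 2 + X ^ 3) +
    X ^ 4 * expand ℤ 5 (5 + 20 * X + 20 * X ^ 2) := by
  simp only [dissectionCofactor, map_add, map_sub, map_mul, map_pow, map_neg, map_one, map_zero,
    map_ofNat, expand_X]
  ring

theorem expand_five_cofactor_pow_three : ((X * dissectionCofactor) ^ 3 : ℤ[X]) =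
    expand ℤ 5 (9 * X + 177 * X ^ 2 + 71 * X ^ 3 - 177 * X ^ 4 + 9 * X ^ 5) +
    X * expand ℤ 5 (22 * X + 216 * X ^ 2 - 57 * X ^ 3 + 134 * X ^ 4 - 3 * X ^ 5) +
    X ^ 2 * expand ℤ 5 (51 * X + 153 * X ^ 2 + 219 * X ^ 3 - 78 * X ^ 4 + X ^ 5) +
    X ^ 3 * expand ℤ 5 (1 + 78 * X + 219 * X ^ 2 - 153 * X ^ 3 + 51 * X ^ 4) +
    X ^ 4 * expand ℤ 5 (3 + 134 * X + 57 * X ^ 2 + 216 * X ^ 3 - 22 * X ^ 4) := by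
  simp only [dissectionCofactor, map_add, map_sub, map_mul, map_pow, map_neg, map_one, map_zero,
    map_ofNat, expand_X]
  ring

theorem expand_five_cofactor_pow_four : ((X * dissectionCofactor) ^ 4 : ℤ[X]) =
    expand ℤ 5 (4 * X + 418 * X ^ 2 + 1840 * X ^ 3 + 1015 * X ^ 4 - 1840 * X ^ 5 + 418 * X ^ 6 -
      4 * X ^ 7) +
    X * expand ℤ 5 (14 * X + 708 * X ^ 2 + 1815 * X ^ 3 - 60 * X ^ 4 + 1860 * X ^ 5 - 212 * X ^ 6
      + X ^ 7) +
    X ^ 2 * expand ℤ 5 (40 * X + 1100 * X ^ 2 + 1200 * X ^ 3 + 1500 * X ^ 4 - 1400 * X ^ 5 +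
      105 * X ^ 6) +
    X ^ 3 * expand ℤ 5 (105 * X + 1400 * X ^ 2 + 1500 * X ^ 3 - 1200 * X ^ 4 + 1100 * X ^ 5 -
      40 * X ^ 6) +
    X ^ 4 * expand ℤ 5 (1 + 212 * X + 1860 * X ^ 2 + 60 * X ^ 3 + 1815 * X ^ 4 - 708 * X ^ 5 +
      14 * X ^ 6) := by
  simp only [dissectionCofactor, map_add, map_sub, map_mul, map_pow, map_neg, map_one, map_zero,
    map_ofNat, expand_X]
  ring

end Polynomial

/-! ### The action of `section₅ 0` on the powers of `f` and on the auxiliary products. -/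

namespace PowerSeries

theorem sum_X_pow_mul_section₅ (g : ℤ⟦X⟧) :
    ∑ j ∈ Finset.range 5, X ^ j * dilate₅ (section₅ j g) = g := by
  ext n
  rw [map_sum, Finset.sum_eq_single (n % 5)]
  · rw [coeff_X_pow_mul', coeff_expand, if_pos (Nat.mod_le n 5), if_pos (by omega),
      coeff_section₅]
    congr 2
    omega
  · intro j hj hne
    rw [Finset.mem_range] at hj
    rw [coeff_X_pow_mul', coeff_expand]
    split_ifs
    · omega
    · rfl
    · rfl
  · intro h
    exact absurd (Finset.mem_range.2 (Nat.mod_lt n (by norm_num))) h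

theorem section₅_dilate₅_mul (a g : ℤ⟦X⟧) {i : ℕ} (hi : i < 5) :
    section₅ i (dilate₅ a * g) = a * section₅ i g := by
  conv_lhs => rw [← sum_X_pow_mul_section₅ g, Finset.mul_sum]
  rw [← section₅_sum hi fun j => a * section₅ j g]
  congr 1
  refine Finset.sum_congr rfl fun j _ => ?_
  rw [map_mul]
  ring

/-- Extraction of the exponents divisible by `5` in a polynomial expression. -/
theorem section₅_dilate₅_mul_aeval (a y : ℤ⟦X⟧) (p b₀ b₁ b₂ b₃ b₄ : Polynomial ℤ)
    (h : p = Polynomial.expand ℤ 5 b₀ + Polynomial.X * Polynomial.expand ℤ 5 b₁ +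
      Polynomial.X ^ 2 * Polynomial.expand ℤ 5 b₂ + Polynomial.X ^ 3 * Polynomial.expand ℤ 5 b₃ +
      Polynomial.X ^ 4 * Polynomial.expand ℤ 5 b₄) :
    section₅ 0 (dilate₅ a * Polynomial.aeval (X * dilate₅ y) p) =
      a * Polynomial.aeval (X * y ^ 5) b₀ := by
  have hD : ∀ b : Polynomial ℤ, Polynomial.aeval ((X * dilate₅ y) ^ 5) b =
      dilate₅ (Polynomial.aeval (X * y ^ 5) b) := by
    intro b
    rw [← Polynomial.aeval_algHom_apply, map_mul, map_pow, mul_pow, expand_X]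
  rw [section₅_dilate₅_mul _ _ (by norm_num), h]
  refine congrArg (a * ·) ?_
  have := section₅_sum_eq (i := 0) (by norm_num) (Polynomial.aeval (X * y ^ 5) b₀)
    (y * Polynomial.aeval (X * y ^ 5) b₁) (y ^ 2 * Polynomial.aeval (X * y ^ 5) b₂)
    (y ^ 3 * Polynomial.aeval (X * y ^ 5) b₃) (y ^ 4 * Polynomial.aeval (X * y ^ 5) b₄)
  rw [List.getD_cons_zero] at this
  refine Eq.trans (congrArg (section₅ 0) ?_) this
  simp only [map_add, map_mul, map_pow, Polynomial.aeval_X, Polynomial.expand_aeval, hD]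
  ring

/-- Dividing the dissection by `x(q^5)`, whose inverse is `y(q^5)`, leaves a polynomial in the
single series `z = q y(q^5)`. -/
theorem pentagonalSeries_eq_mul_aeval {x y : ℤ⟦X⟧} (hxy : x * y = 1)
    (h : pentagonalSeries ℤ = dilate₅ (dilate₅ (pentagonalSeries ℤ)) *
      (dilate₅ x - X - X ^ 2 * dilate₅ y)) :
    pentagonalSeries ℤ = dilate₅ (dilate₅ (pentagonalSeries ℤ) * x) *
      Polynomial.aeval (X * dilate₅ y) (1 - Polynomial.X - Polynomial.X ^ 2 : Polynomial ℤ) := by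
  have hxy' := congrArg dilate₅ hxy
  rw [map_mul, map_one] at hxy'
  conv_lhs => rw [h]
  simp only [map_mul, map_sub, map_one, map_pow, Polynomial.aeval_X]
  linear_combination dilate₅ (dilate₅ (pentagonalSeries ℤ)) * (X + X ^ 2 * dilate₅ y) * hxy'

theorem section₅_X_pow_mul_pentagonalSeries_pow {x y : ℤ⟦X⟧} (hxy : x * y = 1)
    (h : pentagonalSeries ℤ = dilate₅ (dilate₅ (pentagonalSeries ℤ)) *
      (dilate₅ x - X - X ^ 2 * dilate₅ y)) (s k : ℕ) (b₀ b₁ b₂ b₃ b₄ : Polynomial ℤ)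
    (hb : Polynomial.X ^ s * (1 - Polynomial.X - Polynomial.X ^ 2) ^ k =
      Polynomial.expand ℤ 5 b₀ + Polynomial.X * Polynomial.expand ℤ 5 b₁ +
      Polynomial.X ^ 2 * Polynomial.expand ℤ 5 b₂ + Polynomial.X ^ 3 * Polynomial.expand ℤ 5 b₃ +
      Polynomial.X ^ 4 * Polynomial.expand ℤ 5 b₄) :
    section₅ 0 (X ^ s * pentagonalSeries ℤ ^ k) = dilate₅ (pentagonalSeries ℤ) ^ k *
      (x ^ (s + k) * Polynomial.aeval (X * y ^ 5) b₀) := by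
  have hX : X = dilate₅ x * (X * dilate₅ y) := by
    have hxy' := congrArg dilate₅ hxy
    rw [map_mul, map_one] at hxy'
    linear_combination -X * hxy'
  have hE := pentagonalSeries_eq_mul_aeval hxy h
  have := section₅_dilate₅_mul_aeval (dilate₅ (pentagonalSeries ℤ) ^ k * x ^ (s + k)) y _ _ _ _ _ _
    hb
  rw [← mul_assoc, ← this]
  congr 1
  calc X ^ s * pentagonalSeries ℤ ^ k = (dilate₅ x * (X * dilate₅ y)) ^ s *
      (dilate₅ (dilate₅ (pentagonalSeries ℤ) * x) * Polynomial.aeval (X * dilate₅ y)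
        (1 - Polynomial.X - Polynomial.X ^ 2 : Polynomial ℤ)) ^ k :=
        congrArg₂ (fun a b => a ^ s * b ^ k) hX hE
    _ = _ := by
      simp only [map_mul, map_pow, Polynomial.aeval_X]
      ring

theorem section₅_X_mul_pow_four :
    section₅ 0 (X ^ 1 * pentagonalSeries ℤ ^ 4) =
      -5 * X * dilate₅ (pentagonalSeries ℤ) ^ 4 := by
  obtain ⟨x, y, hxy, h⟩ := exists_pentagonalSeries_dissection
  have h5 : x ^ 5 * y ^ 5 = 1 := by rw [← mul_pow, hxy, one_pow]
  rw [section₅_X_pow_mul_pentagonalSeries_pow hxy h _ _ _ _ _ _ _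
    Polynomial.expand_five_X_mul_pow_four]
  simp only [map_add, map_sub, map_mul, map_pow, map_neg, map_one, map_zero, map_ofNat,
    Polynomial.aeval_X]
  generalize dilate₅ (pentagonalSeries ℤ) = E at *
  linear_combination -5 * X * E ^ 4 * h5

theorem section₅_X_sq_mul_pow_three :
    section₅ 0 (X ^ 2 * pentagonalSeries ℤ ^ 3) =
      5 * X * dilate₅ (pentagonalSeries ℤ) ^ 3 := by
  obtain ⟨x, y, hxy, h⟩ := exists_pentagonalSeries_dissection
  have h5 : x ^ 5 * y ^ 5 = 1 := by rw [← mul_pow, hxy, one_pow]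
  rw [section₅_X_pow_mul_pentagonalSeries_pow hxy h _ _ _ _ _ _ _
    Polynomial.expand_five_X_sq_mul_pow_three]
  simp only [map_add, map_sub, map_mul, map_pow, map_neg, map_one, map_zero, map_ofNat,
    Polynomial.aeval_X]
  generalize dilate₅ (pentagonalSeries ℤ) = E at *
  linear_combination 5 * X * E ^ 3 * h5

theorem section₅_X_pow_three_mul_sq :
    section₅ 0 (X ^ 3 * pentagonalSeries ℤ ^ 2) =
      -X * dilate₅ (pentagonalSeries ℤ) ^ 2 := by
  obtain ⟨x, y, hxy, h⟩ := exists_pentagonalSeries_dissection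
  have h5 : x ^ 5 * y ^ 5 = 1 := by rw [← mul_pow, hxy, one_pow]
  rw [section₅_X_pow_mul_pentagonalSeries_pow hxy h _ _ _ _ _ _ _
    Polynomial.expand_five_X_pow_three_mul_sq]
  simp only [map_add, map_sub, map_mul, map_pow, map_neg, map_one, map_zero, map_ofNat,
    Polynomial.aeval_X]
  generalize dilate₅ (pentagonalSeries ℤ) = E at *
  linear_combination -X * E ^ 2 * h5

theorem section₅_X_sq_mul_pow_eight :
    section₅ 0 (X ^ 2 * pentagonalSeries ℤ ^ 8) =
      -125 * X ^ 2 * dilate₅ (pentagonalSeries ℤ) ^ 8 := by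
  obtain ⟨x, y, hxy, h⟩ := exists_pentagonalSeries_dissection
  have h5 : x ^ 5 * y ^ 5 = 1 := by rw [← mul_pow, hxy, one_pow]
  rw [section₅_X_pow_mul_pentagonalSeries_pow hxy h _ _ _ _ _ _ _
    Polynomial.expand_five_X_sq_mul_pow_eight]
  simp only [map_add, map_sub, map_mul, map_pow, map_neg, map_one, map_zero, map_ofNat,
    Polynomial.aeval_X]
  generalize dilate₅ (pentagonalSeries ℤ) = E at *
  linear_combination -125 * X ^ 2 * E ^ 8 * (x ^ 5 * y ^ 5 + 1) * h5

theorem section₅_X_mul_pow_fourteen :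
    section₅ 0 (X ^ 1 * pentagonalSeries ℤ ^ 14) =
      -15625 * X ^ 3 * dilate₅ (pentagonalSeries ℤ) ^ 14 := by
  obtain ⟨x, y, hxy, h⟩ := exists_pentagonalSeries_dissection
  have h5 : x ^ 5 * y ^ 5 = 1 := by rw [← mul_pow, hxy, one_pow]
  rw [section₅_X_pow_mul_pentagonalSeries_pow hxy h _ _ _ _ _ _ _
    Polynomial.expand_five_X_mul_pow_fourteen]
  simp only [map_add, map_sub, map_mul, map_pow, map_neg, map_one, map_zero, map_ofNat,
    Polynomial.aeval_X]
  generalize dilate₅ (pentagonalSeries ℤ) = E at *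
  linear_combination -15625 * X ^ 3 * E ^ 14 * (x ^ 10 * y ^ 10 + x ^ 5 * y ^ 5 + 1) * h5

theorem section₅_X_mul_pow_nine :
    section₅ 0 (X ^ 1 * pentagonalSeries ℤ ^ 9) =
      -90 * X * dilate₅ (pentagonalSeries ℤ) ^ 3 * pentagonalSeries ℤ ^ 6 -
        625 * X ^ 2 * dilate₅ (pentagonalSeries ℤ) ^ 9 := by
  obtain ⟨x, y, hxy, h⟩ := exists_pentagonalSeries_dissection
  have h5 : x ^ 5 * y ^ 5 = 1 := by rw [← mul_pow, hxy, one_pow]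
  have h6 := pentagonalSeries_pow_six hxy h
  rw [section₅_X_pow_mul_pentagonalSeries_pow hxy h _ _ _ _ _ _ _
    Polynomial.expand_five_X_mul_pow_nine]
  simp only [map_add, map_sub, map_mul, map_pow, map_neg, map_one, map_zero, map_ofNat,
    Polynomial.aeval_X]
  generalize dilate₅ (pentagonalSeries ℤ) = E at *
  linear_combination 90 * X * E ^ 3 * h6 + E ^ 9 * (-90 * X * x ^ 5 +
    365 * X ^ 2 * (x ^ 5 * y ^ 5 + 1) + 90 * X ^ 3 * y ^ 5 * (x ^ 5 * y ^ 5 + 1)) * h5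

theorem pentagonalSeries_ne_zero : pentagonalSeries ℤ ≠ 0 := isUnit_pentagonalSeries.ne_zero

/-- The denominator `E` of `f` is rationalised: multiplied by the cofactor, `1 - z - z^2` becomes
its norm, which `pentagonalSeries_pow_six` at `q^5` expresses through `E(q^5)^6`. -/
theorem mul_dilate₅_eq_mul_aeval {x y f : ℤ⟦X⟧} (hxy : x * y = 1)
    (h : pentagonalSeries ℤ = dilate₅ (dilate₅ (pentagonalSeries ℤ)) *
      (dilate₅ x - X - X ^ 2 * dilate₅ y))
    (hf : f * pentagonalSeries ℤ = X * dilate₅ (pentagonalSeries ℤ) ^ 5) :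
    f * dilate₅ (pentagonalSeries ℤ) = dilate₅ (dilate₅ (pentagonalSeries ℤ) ^ 5 * x ^ 5) *
      Polynomial.aeval (X * dilate₅ y) (Polynomial.X * Polynomial.dissectionCofactor) := by
  refine mul_left_cancel₀ pentagonalSeries_ne_zero ?_
  have h6 := congrArg dilate₅ (pentagonalSeries_pow_six hxy h)
  have hE := pentagonalSeries_eq_mul_aeval hxy h
  have hc := congrArg (Polynomial.aeval (X * dilate₅ y) : Polynomial ℤ →ₐ[ℤ] ℤ⟦X⟧)
    Polynomial.mul_dissectionCofactor
  have hxy' := congrArg dilate₅ hxy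
  rw [map_mul, map_one] at hxy'
  have h5 : dilate₅ x ^ 5 * dilate₅ y ^ 5 = 1 := by rw [← mul_pow, hxy', one_pow]
  rw [map_mul] at hc
  calc pentagonalSeries ℤ * (f * dilate₅ (pentagonalSeries ℤ))
      = X * dilate₅ (pentagonalSeries ℤ ^ 6) := by
        rw [map_pow]; linear_combination dilate₅ (pentagonalSeries ℤ) * hf
    _ = (dilate₅ (dilate₅ (pentagonalSeries ℤ) * x) *
      Polynomial.aeval (X * dilate₅ y) (1 - Polynomial.X - Polynomial.X ^ 2 : Polynomial ℤ)) *
      (dilate₅ (dilate₅ (pentagonalSeries ℤ) ^ 5 * x ^ 5) *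
      Polynomial.aeval (X * dilate₅ y) (Polynomial.X * Polynomial.dissectionCofactor)) := by
        rw [h6]
        simp only [map_mul, map_pow, Polynomial.aeval_X, map_sub, map_one, map_ofNat,
          expand_X] at hc ⊢
        generalize Polynomial.aeval (X * dilate₅ y) Polynomial.dissectionCofactor = c at *
        generalize dilate₅ (dilate₅ (pentagonalSeries ℤ)) = F
        generalize dilate₅ x = x' at *
        generalize dilate₅ y = y' at *
        linear_combination F ^ 6 * (-x' ^ 6 * X * y' * hc
          - (X * x' ^ 5 - X * x' ^ 5 * 11 * X ^ 5 * y' ^ 5 - X * x' ^ 5 * X ^ 10 * y' ^ 10) * hxy'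
          + X * (11 * X ^ 5 + X ^ 10 * y' ^ 5) * h5)
    _ = _ := by rw [← hE]

theorem pow_mul_section₅_pow {x y f : ℤ⟦X⟧} (hxy : x * y = 1)
    (h : pentagonalSeries ℤ = dilate₅ (dilate₅ (pentagonalSeries ℤ)) *
      (dilate₅ x - X - X ^ 2 * dilate₅ y))
    (hf : f * pentagonalSeries ℤ = X * dilate₅ (pentagonalSeries ℤ) ^ 5)
    (k : ℕ) (b₀ b₁ b₂ b₃ b₄ : Polynomial ℤ)
    (hb : (Polynomial.X * Polynomial.dissectionCofactor) ^ k =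
      Polynomial.expand ℤ 5 b₀ + Polynomial.X * Polynomial.expand ℤ 5 b₁ +
      Polynomial.X ^ 2 * Polynomial.expand ℤ 5 b₂ + Polynomial.X ^ 3 * Polynomial.expand ℤ 5 b₃ +
      Polynomial.X ^ 4 * Polynomial.expand ℤ 5 b₄) :
    pentagonalSeries ℤ ^ k * section₅ 0 (f ^ k) =
      (dilate₅ (pentagonalSeries ℤ) ^ 5 * x ^ 5) ^ k *
        Polynomial.aeval (X * y ^ 5) b₀ := by
  rw [← section₅_dilate₅_mul _ _ (by norm_num), ← section₅_dilate₅_mul_aeval _ _ _ _ _ _ _ _ hb,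
    map_pow, map_pow, map_pow, ← mul_pow, ← mul_pow, mul_comm _ f,
    mul_dilate₅_eq_mul_aeval hxy h hf]

/-- With `w = X y^5` and `P = 1 - 11w - w^2`, these relations eliminate `x` and `y`: a form of
degree `k` in `w`, `P`, times `x^(5k)`, becomes a form in `X` and `E^6 / E(q^5)^6`. -/
theorem exists_pentagonalSeries_parametrization {x y : ℤ⟦X⟧} (hxy : x * y = 1)
    (h : pentagonalSeries ℤ = dilate₅ (dilate₅ (pentagonalSeries ℤ)) *
      (dilate₅ x - X - X ^ 2 * dilate₅ y)) :
    X = X * y ^ 5 * x ^ 5 ∧ pentagonalSeries ℤ ^ 6 = dilate₅ (pentagonalSeries ℤ) ^ 6 *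
      (x ^ 5 * (1 - 11 * (X * y ^ 5) - (X * y ^ 5) ^ 2)) := by
  have h5 : x ^ 5 * y ^ 5 = 1 := by rw [← mul_pow, hxy, one_pow]
  have h6 := pentagonalSeries_pow_six hxy h
  constructor
  · linear_combination -X * h5
  · linear_combination h6 + dilate₅ (pentagonalSeries ℤ) ^ 6 * (11 * X + X ^ 2 * y ^ 5) * h5

/-- The coefficients are those of `125 w^2 + 10 w P`. The cube comes likewise from `3125 w^3 + 375
w^2 P + 9 w P^2`, and the fourth power from `78125 w^4 + 12500 w^3 P + 550 w^2 P^2 + 4 w P^3`. -/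
theorem section₅_sq {f : ℤ⟦X⟧}
    (hf : f * pentagonalSeries ℤ = X * dilate₅ (pentagonalSeries ℤ) ^ 5) :
    section₅ 0 (f ^ 2) = (125 : ℤ) • f ^ 2 + (10 : ℤ) •
      (dilate₅ (pentagonalSeries ℤ ^ 4) * (X ^ 1 * pentagonalSeries ℤ ^ 4)) := by
  obtain ⟨x, y, hxy, h⟩ := exists_pentagonalSeries_dissection
  refine mul_left_cancel₀ (pow_ne_zero 2 pentagonalSeries_ne_zero) ?_
  obtain ⟨hX, h6⟩ := exists_pentagonalSeries_parametrization hxy h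
  rw [pow_mul_section₅_pow hxy h hf _ _ _ _ _ _ Polynomial.expand_five_cofactor_pow_two]
  simp only [map_add, map_sub, map_mul, map_pow, map_neg, map_one, map_zero, map_ofNat,
    Polynomial.aeval_X, zsmul_eq_mul, Int.cast_ofNat]
  generalize X * y ^ 5 = w at *
  generalize dilate₅ (pentagonalSeries ℤ) = F at *
  generalize pentagonalSeries ℤ = E at *
  symm
  calc _ = 125 * (f * E) ^ 2 + 10 * F ^ 4 * X * E ^ 6 := by ring
    _ = _ := by
      rw [hf, h6, hX]
      ring

theorem section₅_cube {f : ℤ⟦X⟧}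
    (hf : f * pentagonalSeries ℤ = X * dilate₅ (pentagonalSeries ℤ) ^ 5) :
    section₅ 0 (f ^ 3) = (3125 : ℤ) • f ^ 3 +
      (375 : ℤ) • (dilate₅ (pentagonalSeries ℤ ^ 9) * (X ^ 2 * pentagonalSeries ℤ ^ 3)) +
      (9 : ℤ) • (dilate₅ (pentagonalSeries ℤ ^ 3) * (X ^ 1 * pentagonalSeries ℤ ^ 9)) := by
  obtain ⟨x, y, hxy, h⟩ := exists_pentagonalSeries_dissection
  refine mul_left_cancel₀ (pow_ne_zero 3 pentagonalSeries_ne_zero) ?_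
  obtain ⟨hX, h6⟩ := exists_pentagonalSeries_parametrization hxy h
  rw [pow_mul_section₅_pow hxy h hf _ _ _ _ _ _ Polynomial.expand_five_cofactor_pow_three]
  simp only [map_add, map_sub, map_mul, map_pow, map_neg, map_one, map_zero, map_ofNat,
    Polynomial.aeval_X, zsmul_eq_mul, Int.cast_ofNat]
  generalize X * y ^ 5 = w at *
  generalize dilate₅ (pentagonalSeries ℤ) = F at *
  generalize pentagonalSeries ℤ = E at *
  symm
  calc _ = 3125 * (f * E) ^ 3 + 375 * F ^ 9 * X ^ 2 * E ^ 6 + 9 * F ^ 3 * X * (E ^ 6) ^ 2 := by ring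
    _ = _ := by
      rw [hf, h6, hX]
      ring

theorem section₅_pow_four {f : ℤ⟦X⟧}
    (hf : f * pentagonalSeries ℤ = X * dilate₅ (pentagonalSeries ℤ) ^ 5) :
    section₅ 0 (f ^ 4) = (78125 : ℤ) • f ^ 4 +
      (12500 : ℤ) • (dilate₅ (pentagonalSeries ℤ ^ 14) * (X ^ 3 * pentagonalSeries ℤ ^ 2)) +
      (550 : ℤ) • (dilate₅ (pentagonalSeries ℤ ^ 8) * (X ^ 2 * pentagonalSeries ℤ ^ 8)) +
      (4 : ℤ) • (dilate₅ (pentagonalSeries ℤ ^ 2) * (X ^ 1 * pentagonalSeries ℤ ^ 14)) := by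
  obtain ⟨x, y, hxy, h⟩ := exists_pentagonalSeries_dissection
  refine mul_left_cancel₀ (pow_ne_zero 4 pentagonalSeries_ne_zero) ?_
  obtain ⟨hX, h6⟩ := exists_pentagonalSeries_parametrization hxy h
  rw [pow_mul_section₅_pow hxy h hf _ _ _ _ _ _ Polynomial.expand_five_cofactor_pow_four]
  simp only [map_add, map_sub, map_mul, map_pow, map_neg, map_one, map_zero, map_ofNat,
    Polynomial.aeval_X, zsmul_eq_mul, Int.cast_ofNat]
  generalize X * y ^ 5 = w at *
  generalize dilate₅ (pentagonalSeries ℤ) = F at *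
  generalize pentagonalSeries ℤ = E at *
  symm
  calc _ = 78125 * (f * E) ^ 4 + 12500 * F ^ 14 * X ^ 3 * E ^ 6 +
      550 * F ^ 8 * X ^ 2 * (E ^ 6) ^ 2 +
      4 * F ^ 2 * X * (E ^ 6) ^ 3 := by ring
    _ = _ := by
      rw [hf, h6, hX]
      ring

/-- This lemma and the next five give the matrix of `section₅ 0` on the auxiliary products: two are
eigenvectors, the other four form two stable pairs. -/
theorem section₅_dilate₅_mul_X_mul_pow_four :
    section₅ 0 (dilate₅ (pentagonalSeries ℤ ^ 4) * (X ^ 1 * pentagonalSeries ℤ ^ 4)) =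
      (-5 : ℤ) • (dilate₅ (pentagonalSeries ℤ ^ 4) * (X ^ 1 * pentagonalSeries ℤ ^ 4)) := by
  rw [section₅_dilate₅_mul _ _ (by norm_num), section₅_X_mul_pow_four]
  simp only [map_pow, zsmul_eq_mul, Int.cast_neg, Int.cast_ofNat]
  ring

theorem section₅_dilate₅_mul_X_sq_mul_pow_three :
    section₅ 0 (dilate₅ (pentagonalSeries ℤ ^ 9) * (X ^ 2 * pentagonalSeries ℤ ^ 3)) =
      (5 : ℤ) • (dilate₅ (pentagonalSeries ℤ ^ 3) * (X ^ 1 * pentagonalSeries ℤ ^ 9)) := by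
  rw [section₅_dilate₅_mul _ _ (by norm_num), section₅_X_sq_mul_pow_three]
  simp only [map_pow, zsmul_eq_mul, Int.cast_neg, Int.cast_ofNat]
  ring

theorem section₅_dilate₅_mul_X_mul_pow_nine :
    section₅ 0 (dilate₅ (pentagonalSeries ℤ ^ 3) * (X ^ 1 * pentagonalSeries ℤ ^ 9)) =
      (-90 : ℤ) • (dilate₅ (pentagonalSeries ℤ ^ 3) * (X ^ 1 * pentagonalSeries ℤ ^ 9)) +
      (-625 : ℤ) • (dilate₅ (pentagonalSeries ℤ ^ 9) * (X ^ 2 * pentagonalSeries ℤ ^ 3)) := by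
  rw [section₅_dilate₅_mul _ _ (by norm_num), section₅_X_mul_pow_nine]
  simp only [map_pow, zsmul_eq_mul, Int.cast_neg, Int.cast_ofNat]
  ring

theorem section₅_dilate₅_mul_X_pow_three_mul_sq :
    section₅ 0 (dilate₅ (pentagonalSeries ℤ ^ 14) * (X ^ 3 * pentagonalSeries ℤ ^ 2)) =
      (-1 : ℤ) • (dilate₅ (pentagonalSeries ℤ ^ 2) * (X ^ 1 * pentagonalSeries ℤ ^ 14)) := by
  rw [section₅_dilate₅_mul _ _ (by norm_num), section₅_X_pow_three_mul_sq]
  simp only [map_pow, zsmul_eq_mul, Int.cast_neg, Int.cast_one]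
  ring

theorem section₅_dilate₅_mul_X_sq_mul_pow_eight :
    section₅ 0 (dilate₅ (pentagonalSeries ℤ ^ 8) * (X ^ 2 * pentagonalSeries ℤ ^ 8)) =
      (-125 : ℤ) • (dilate₅ (pentagonalSeries ℤ ^ 8) * (X ^ 2 * pentagonalSeries ℤ ^ 8)) := by
  rw [section₅_dilate₅_mul _ _ (by norm_num), section₅_X_sq_mul_pow_eight]
  simp only [map_pow, zsmul_eq_mul, Int.cast_neg, Int.cast_ofNat]
  ring

theorem section₅_dilate₅_mul_X_mul_pow_fourteen :
    section₅ 0 (dilate₅ (pentagonalSeries ℤ ^ 2) * (X ^ 1 * pentagonalSeries ℤ ^ 14)) =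
      (-15625 : ℤ) • (dilate₅ (pentagonalSeries ℤ ^ 14) * (X ^ 3 * pentagonalSeries ℤ ^ 2)) := by
  rw [section₅_dilate₅_mul _ _ (by norm_num), section₅_X_mul_pow_fourteen]
  simp only [map_pow, zsmul_eq_mul, Int.cast_neg, Int.cast_ofNat]
  ring

theorem coeff_pow_eq_coeff_section₅ {c : ℤ⟦X⟧} {k m : ℕ} (n : ℕ) (hm : m + k = 25 * n) :
    coeff m (c ^ k) = coeff n (section₅ 0 (section₅ 0 ((X * c) ^ k))) := by
  rw [coeff_section₅, coeff_section₅, mul_pow, show 5 * (5 * n + 0) + 0 = m + k by omega,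
    coeff_X_pow_mul]

theorem coeff_pow_eq_coeff_section₅_section₅ {c : ℤ⟦X⟧} {k m : ℕ} (n : ℕ)
    (hm : m + k = 125 * n) :
    coeff m (c ^ k) = coeff n (section₅ 0 (section₅ 0 (section₅ 0 ((X * c) ^ k)))) := by
  rw [coeff_section₅, ← coeff_pow_eq_coeff_section₅]
  omega

theorem dvd_coeff_pow {c : ℤ⟦X⟧}
    (hc : c * pentagonalSeries ℤ = dilate₅ (pentagonalSeries ℤ) ^ 5) (n : ℕ) :
    25 ∣ coeff (25 * n + 23) (c ^ 2) ∧ 125 ∣ coeff (125 * n + 123) (c ^ 2) ∧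
    5 ∣ coeff (25 * n + 22) (c ^ 3) ∧ 25 ∣ coeff (125 * n + 122) (c ^ 3) ∧
    3125 ∣ coeff (25 * n + 21) (c ^ 4) ∧ 15625 ∣ coeff (125 * n + 121) (c ^ 4) := by
  have hf : (X * c) * pentagonalSeries ℤ = X * dilate₅ (pentagonalSeries ℤ) ^ 5 := by
    rw [mul_assoc, hc]
  rw [coeff_pow_eq_coeff_section₅ (m := 25 * n + 23) (n + 1) (by ring),
    coeff_pow_eq_coeff_section₅ (m := 25 * n + 22) (n + 1) (by ring),
    coeff_pow_eq_coeff_section₅ (m := 25 * n + 21) (n + 1) (by ring),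
    coeff_pow_eq_coeff_section₅_section₅ (m := 125 * n + 123) (n + 1) (by ring),
    coeff_pow_eq_coeff_section₅_section₅ (m := 125 * n + 122) (n + 1) (by ring),
    coeff_pow_eq_coeff_section₅_section₅ (m := 125 * n + 121) (n + 1) (by ring)]
  simp only [section₅_sq hf, section₅_cube hf, section₅_pow_four hf, map_add, map_zsmul,
    section₅_dilate₅_mul_X_mul_pow_four, section₅_dilate₅_mul_X_sq_mul_pow_three,
    section₅_dilate₅_mul_X_mul_pow_nine, section₅_dilate₅_mul_X_pow_three_mul_sq,
    section₅_dilate₅_mul_X_sq_mul_pow_eight, section₅_dilate₅_mul_X_mul_pow_fourteen, smul_eq_mul]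
  -- Each coefficient is now an explicit integer combination of coefficients at `n + 1`, every
  -- multiplier being divisible by the modulus.
  refine ⟨?_, ?_, ?_, ?_, ?_, ?_⟩ <;> omega

end PowerSeries

/-! ### Beta-numbers, and cores as left-justified abaci. -/

namespace YoungDiagram

theorem lt_card_of_rowLen_ne_zero {μ : YoungDiagram} {N : ℕ} (h : μ.rowLen N ≠ 0) :
    N < μ.card := by
  have hc : (N, 0) ∈ μ := mem_iff_lt_rowLen.2 (Nat.pos_of_ne_zero h)
  have := Finset.card_le_card_of_injOn (s := Finset.range (N + 1)) (t := μ.cells)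
    (fun a => (a, 0))
    (fun a ha => μ.up_left_mem (by simpa [Nat.lt_succ_iff] using ha) le_rfl hc)
    (fun a _ b _ h => (Prod.mk.inj h).1)
  simpa using this

theorem card_eq_sum_rowLen {μ : YoungDiagram} {N : ℕ} (h : μ.rowLen N = 0) :
    μ.card = ∑ i ∈ Finset.range N, μ.rowLen i := by
  rw [YoungDiagram.card, Finset.card_eq_sum_card_fiberwise (f := Prod.fst) (t := Finset.range N)]
  · refine Finset.sum_congr rfl fun i _ => ?_
    rw [rowLen_eq_card]
    rfl
  · rintro ⟨i, j⟩ hij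
    have hij' : (i, j) ∈ μ := hij
    rw [mem_iff_lt_rowLen] at hij'
    simp only [Finset.coe_range, Set.mem_Iio]
    by_contra hi
    have := μ.rowLen_anti N i (not_lt.1 hi)
    omega

/-- The beta-numbers of a Young diagram, with respect to `N` beads. -/
def betaSet (μ : YoungDiagram) (N : ℕ) : Finset ℕ :=
  (Finset.range N).image fun i => μ.rowLen i + (N - 1 - i)

theorem mem_betaSet {μ : YoungDiagram} {N x : ℕ} :
    x ∈ μ.betaSet N ↔ ∃ i < N, μ.rowLen i + (N - 1 - i) = x := by
  simp [betaSet]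

theorem injOn_beta (μ : YoungDiagram) (N : ℕ) :
    Set.InjOn (fun i => μ.rowLen i + (N - 1 - i)) (Finset.range N) := by
  intro i hi j hj h
  simp only [Finset.coe_range, Set.mem_Iio] at hi hj h
  rcases lt_trichotomy i j with hij | hij | hij
  · have := μ.rowLen_anti i j hij.le
    omega
  · exact hij
  · have := μ.rowLen_anti j i hij.le
    omega

theorem card_betaSet (μ : YoungDiagram) (N : ℕ) : (μ.betaSet N).card = N := by
  rw [betaSet, Finset.card_image_of_injOn (μ.injOn_beta N), Finset.card_range]

theorem sum_betaSet {μ : YoungDiagram} {N : ℕ} (h : μ.rowLen N = 0) :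
    ∑ x ∈ μ.betaSet N, x = N.choose 2 + μ.card := by
  rw [betaSet, Finset.sum_image (μ.injOn_beta N), Finset.sum_add_distrib, card_eq_sum_rowLen h,
    Finset.sum_range_reflect (fun i => i) N, Finset.sum_range_id, Nat.choose_two_right, add_comm]

theorem orderEmbOfFin_betaSet (μ : YoungDiagram) (N : ℕ) (j : Fin N) :
    (μ.betaSet N).orderEmbOfFin (μ.card_betaSet N) j = μ.rowLen (N - 1 - j) + j := by
  have := Finset.orderEmbOfFin_unique (μ.card_betaSet N)
    (f := fun j : Fin N => μ.rowLen (N - 1 - j) + j) ?_ ?_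
  · exact (congrFun this j).symm
  · intro j
    rw [mem_betaSet]
    exact ⟨N - 1 - j, by omega, by omega⟩
  · intro i j hij
    have hij' : (i : ℕ) < j := hij
    have := μ.rowLen_anti (N - 1 - j) (N - 1 - i) (by omega)
    simp only
    omega

theorem betaSet_injOn (N : ℕ) : Set.InjOn (fun μ : YoungDiagram => μ.betaSet N)
    {μ | μ.rowLen N = 0} := by
  intro μ hμ ν hν h
  simp only [Set.mem_ofPred_eq] at hμ hν h
  have hrow : ∀ i, μ.rowLen i = ν.rowLen i := by
    intro i
    rcases lt_or_ge i N with hi | hi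
    · have h1 := orderEmbOfFin_betaSet μ N ⟨N - 1 - i, by omega⟩
      have h2 := orderEmbOfFin_betaSet ν N ⟨N - 1 - i, by omega⟩
      have h3 : (μ.betaSet N).orderEmbOfFin (μ.card_betaSet N) =
          (ν.betaSet N).orderEmbOfFin (ν.card_betaSet N) := by
        congr 1
      rw [h3, h2] at h1
      simp only at h1
      rw [show N - 1 - (N - 1 - i) = i by omega] at h1
      omega
    · have := μ.rowLen_anti N i hi
      have := ν.rowLen_anti N i hi
      omega
  ext ⟨i, j⟩
  rw [mem_cells, mem_cells, mem_iff_lt_rowLen, mem_iff_lt_rowLen, hrow]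

/-- If `e` enumerates `D` increasingly, the row lengths are `e k - k` in reverse order; strict
monotonicity of `e` makes them non-increasing down the diagram. -/
theorem exists_betaSet_eq {N : ℕ} {D : Finset ℕ} (hD : D.card = N) :
    ∃ μ : YoungDiagram, μ.rowLen N = 0 ∧ μ.betaSet N = D := by
  have hmono := (D.orderEmbOfFin hD).strictMono
  let e : ℕ → ℕ := fun k => if h : k < N then D.orderEmbOfFin hD ⟨k, h⟩ else 0
  have he : ∀ k, k < N → e k ∈ D := fun k hk => by
    simp only [e, dif_pos hk]
    exact D.orderEmbOfFin_mem hD _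
  have he1 : ∀ k, k + 1 < N → e k < e (k + 1) := fun k hk => by
    simp only [e, dif_pos hk, dif_pos (Nat.lt_of_succ_lt hk)]
    exact hmono (by simp [Fin.lt_def])
  have he2 : ∀ a b, a + b < N → e a + b ≤ e (a + b) := by
    intro a b
    induction b with
    | zero => simp
    | succ b ih =>
      intro h
      have := ih (by omega)
      have := he1 (a + b) (by omega)
      have : a + (b + 1) = a + b + 1 := rfl
      rw [this]
      omega
  have he0 : ∀ k, k < N → k ≤ e k := fun k hk => by
    have := he2 0 k (by omega)
    rw [zero_add] at this
    omega
  have hanti : ∀ i i', i ≤ i' → i' < N →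
      e (N - 1 - i') - (N - 1 - i') ≤ e (N - 1 - i) - (N - 1 - i) := by
    intro i i' hi hi'
    have := he2 (N - 1 - i') (i' - i) (by omega)
    rw [show N - 1 - i' + (i' - i) = N - 1 - i by omega] at this
    omega
  let S : Finset (ℕ × ℕ) := (Finset.range N).biUnion fun i =>
    (Finset.range (e (N - 1 - i) - (N - 1 - i))).image fun j => (i, j)
  have hS : ∀ i j, (i, j) ∈ S ↔ i < N ∧ j < e (N - 1 - i) - (N - 1 - i) := by
    intro i j
    simp [S]
  let μ : YoungDiagram := ⟨S, by
    rintro ⟨i', j'⟩ ⟨i, j⟩ hle hmem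
    obtain ⟨hi, hj⟩ : i ≤ i' ∧ j ≤ j' := hle
    have hmem' : (i', j') ∈ S := hmem
    rw [hS] at hmem'
    refine (hS i j).2 ⟨by omega, ?_⟩
    have := hanti i i' hi hmem'.1
    omega⟩
  have hrow : ∀ i, i < N → μ.rowLen i = e (N - 1 - i) - (N - 1 - i) := by
    intro i hi
    have : ∀ j, j < μ.rowLen i ↔ j < e (N - 1 - i) - (N - 1 - i) := fun j => by
      rw [← mem_iff_lt_rowLen]
      exact (hS i j).trans (and_iff_right hi)
    have h1 := this (μ.rowLen i)
    have h2 := this (e (N - 1 - i) - (N - 1 - i))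
    omega
  refine ⟨μ, ?_, ?_⟩
  · by_contra h
    have : (N, 0) ∈ μ := mem_iff_lt_rowLen.2 (Nat.pos_of_ne_zero h)
    exact lt_irrefl N ((hS N 0).1 this).1
  · refine Finset.eq_of_subset_of_card_le ?_ (by rw [card_betaSet, hD])
    intro x hx
    obtain ⟨i, hi, rfl⟩ := mem_betaSet.1 hx
    rw [hrow i hi, Nat.sub_add_cancel (he0 _ (by omega))]
    exact he _ (by omega)

theorem hookNumber_add_one {μ : YoungDiagram} {i j : ℕ} (h : (i, j) ∈ μ) :
    μ.hookNumber (i, j) + 1 = (μ.rowLen i - j) + (μ.colLen j - i) := by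
  have hr := mem_iff_lt_rowLen.1 h
  have hc := mem_iff_lt_colLen.1 h
  have : μ.hook (i, j) = (Finset.Ico j (μ.rowLen i)).image (fun b => (i, b)) ∪
      (Finset.Ico (i + 1) (μ.colLen j)).image (fun a => (a, j)) := by
    ext ⟨a, b⟩
    simp only [hook, Finset.mem_filter, mem_cells, Finset.mem_union, Finset.mem_image,
      Finset.mem_Ico, Prod.mk.injEq]
    constructor
    · rintro ⟨hm, ⟨rfl, hb⟩ | ⟨rfl, ha⟩⟩
      · exact Or.inl ⟨b, ⟨hb, mem_iff_lt_rowLen.1 hm⟩, rfl, rfl⟩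
      · rcases ha.eq_or_lt with rfl | ha
        · exact Or.inl ⟨b, ⟨le_rfl, mem_iff_lt_rowLen.1 hm⟩, rfl, rfl⟩
        · exact Or.inr ⟨a, ⟨ha, mem_iff_lt_colLen.1 hm⟩, rfl, rfl⟩
    · rintro (⟨b', ⟨h1, h2⟩, rfl, rfl⟩ | ⟨a', ⟨h1, h2⟩, rfl, rfl⟩)
      · exact ⟨mem_iff_lt_rowLen.2 h2, Or.inl ⟨rfl, h1⟩⟩
      · exact ⟨mem_iff_lt_colLen.2 h2, Or.inr ⟨rfl, by omega⟩⟩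
  rw [hookNumber, this, Finset.card_union_of_disjoint, Finset.card_image_of_injective,
    Finset.card_image_of_injective, Nat.card_Ico, Nat.card_Ico]
  · omega
  · exact fun a b h => (Prod.mk.inj h).1
  · exact fun a b h => (Prod.mk.inj h).2
  · rw [Finset.disjoint_left]
    rintro ⟨a, b⟩ h1 h2
    simp only [Finset.mem_image, Finset.mem_Ico, Prod.mk.injEq] at h1 h2
    obtain ⟨_, _, rfl, _⟩ := h1
    obtain ⟨_, h2, rfl, _⟩ := h2
    omega

/-- A Young diagram is a `t`-core if and only if its beads are pushed to the left on the abacus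
with `t` runners. -/
theorem isCore_iff_betaSet {μ : YoungDiagram} {N t : ℕ} (h : μ.rowLen N = 0) (ht : 0 < t) :
    μ.IsCore t ↔ ∀ x, x + t ∈ μ.betaSet N → x ∈ μ.betaSet N := by
  constructor
  · intro hcore y hx
    by_contra hy
    obtain ⟨i, hi, hix⟩ := mem_betaSet.1 hx
    -- This says that the bead of row `r` lies below `y`, written without subtraction; the least
    -- such `r` counts the beads above the gap `y`.
    have hex : ∃ r, μ.rowLen r + N ≤ y + r := by
      refine ⟨N + y + μ.rowLen 0 + N, ?_⟩
      have := μ.rowLen_anti 0 (N + y + μ.rowLen 0 + N) (Nat.zero_le _)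
      omega
    classical
    obtain ⟨r, hr, hmin⟩ : ∃ r, μ.rowLen r + N ≤ y + r ∧
        ∀ s < r, ¬ (μ.rowLen s + N ≤ y + s) :=
      ⟨Nat.find hex, Nat.find_spec hex, fun s hs => Nat.find_min hex hs⟩
    have hrN : r ≤ N := by
      by_contra hlt
      exact hmin N (by omega) (by omega)
    have hir : i < r := by
      by_contra hlt
      have := μ.rowLen_anti r i (by omega)
      omega
    have hj1 : ∀ s, s < r → y + r - N < μ.rowLen s := by
      intro s hs
      have h1 := μ.rowLen_anti s (r - 1) (by omega)
      have h2 := hmin (r - 1) (by omega)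
      have h3 : μ.rowLen (r - 1) + (N - 1 - (r - 1)) ≠ y := fun he =>
        hy (mem_betaSet.2 ⟨r - 1, by omega, he⟩)
      omega
    have hcol : μ.colLen (y + r - N) = r := by
      have : ∀ s, s < μ.colLen (y + r - N) ↔ s < r := by
        intro s
        rw [← mem_iff_lt_colLen, mem_iff_lt_rowLen]
        refine ⟨fun hs => ?_, hj1 s⟩
        by_contra hlt
        have := μ.rowLen_anti r s (by omega)
        omega
      have h1 := this (μ.colLen (y + r - N))
      have h2 := this r
      omega
    -- The bead `y + t` of row `i` and the gap `y` determine this cell, whose hook number is their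
    -- difference `t`.
    have hmem : (i, y + r - N) ∈ μ := mem_iff_lt_rowLen.2 (hj1 i hir)
    have hh := hookNumber_add_one hmem
    have hj := hj1 i hir
    rw [hcol] at hh
    exact hcore _ hmem ⟨1, by omega⟩
  · rintro hflush ⟨i, j⟩ hij ⟨k, hk⟩
    have hmem : (i, j) ∈ μ := hij
    have hh := hookNumber_add_one hmem
    have hr := mem_iff_lt_rowLen.1 hmem
    have hc := mem_iff_lt_colLen.1 hmem
    have hcN : μ.colLen j ≤ N := by
      by_contra hlt
      have : (N, j) ∈ μ := mem_iff_lt_colLen.2 (by omega)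
      rw [mem_iff_lt_rowLen] at this
      omega
    have hall : ∀ k x, x + t * k ∈ μ.betaSet N → x ∈ μ.betaSet N := by
      intro k
      induction k with
      | zero => exact fun x hx => hx
      | succ k ih =>
        intro x hx
        exact ih x (hflush _ (by rwa [add_assoc, ← Nat.mul_succ]))
    -- Column `j` corresponds to the gap `N + j - μ.colLen j`, at distance the hook number below the
    -- bead of row `i`. If `t` divides that number, the gap would have to be a bead.
    obtain ⟨l, hl, hly⟩ := mem_betaSet.1 (hall k (N + j - μ.colLen j)
      (mem_betaSet.2 ⟨i, by omega, by omega⟩))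
    rcases lt_or_ge l (μ.colLen j) with hlc | hlc
    · have := mem_iff_lt_rowLen.1 (mem_iff_lt_colLen.2 hlc)
      omega
    · have : ¬ j < μ.rowLen l := fun hlt =>
        absurd (mem_iff_lt_colLen.1 (mem_iff_lt_rowLen.2 hlt)) (by omega)
      omega

end YoungDiagram

/-! ### Counting cores by abacus fillings. -/

/-- The `t`-core partitions of `n`. -/
def corePartitions (t n : ℕ) : Set YoungDiagram :=
  {μ | μ.IsCore t ∧ μ.card = n}

/-- The set of beads of the abacus whose runner `i < t` has its first `l i` places filled. -/
def abacusBeads (t : ℕ) (l : ℕ → ℕ) : Finset ℕ :=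
  ((Finset.range t).sigma fun i => Finset.range (l i)).image fun p => t * p.2 + p.1

theorem mem_abacusBeads {t : ℕ} (ht : 0 < t) {l : ℕ → ℕ} {x : ℕ} :
    x ∈ abacusBeads t l ↔ x / t < l (x % t) := by
  simp only [abacusBeads, Finset.mem_image, Finset.mem_sigma, Finset.mem_range, Sigma.exists]
  constructor
  · rintro ⟨i, j, ⟨hi, hj⟩, rfl⟩
    rwa [Nat.mul_add_div ht, Nat.div_eq_of_lt hi, add_zero, Nat.mul_add_mod, Nat.mod_eq_of_lt hi]
  · intro h
    exact ⟨x % t, x / t, ⟨Nat.mod_lt x ht, h⟩, Nat.div_add_mod x t⟩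

theorem mul_add_mem_abacusBeads {t : ℕ} {l : ℕ → ℕ} {i j : ℕ} (hi : i < t) :
    t * j + i ∈ abacusBeads t l ↔ j < l i := by
  have ht : 0 < t := by omega
  rw [mem_abacusBeads ht, Nat.mul_add_div ht, Nat.div_eq_of_lt hi, add_zero, Nat.mul_add_mod,
    Nat.mod_eq_of_lt hi]

theorem injOn_abacus (t : ℕ) (l : ℕ → ℕ) :
    Set.InjOn (fun p : (_ : ℕ) × ℕ => t * p.2 + p.1)
      ((Finset.range t).sigma fun i => Finset.range (l i)) := by
  rintro ⟨i, j⟩ h ⟨i', j'⟩ h' he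
  simp only [Finset.mem_coe, Finset.mem_sigma, Finset.mem_range] at h h' he
  have ht : 0 < t := by omega
  have h1 := congrArg (· / t) he
  have h2 := congrArg (· % t) he
  simp only [Nat.mul_add_div ht, Nat.div_eq_of_lt h.1, Nat.div_eq_of_lt h'.1, Nat.mul_add_mod,
    Nat.mod_eq_of_lt h.1, Nat.mod_eq_of_lt h'.1, add_zero] at h1 h2
  rw [h1, h2]

theorem card_abacusBeads (t : ℕ) (l : ℕ → ℕ) :
    (abacusBeads t l).card = ∑ i ∈ Finset.range t, l i := by
  rw [abacusBeads, Finset.card_image_of_injOn (injOn_abacus t l), Finset.card_sigma]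
  simp

theorem sum_abacusBeads (t : ℕ) (l : ℕ → ℕ) :
    ∑ x ∈ abacusBeads t l, x = ∑ i ∈ Finset.range t, (i * l i + t * (l i).choose 2) := by
  rw [abacusBeads, Finset.sum_image (injOn_abacus t l), Finset.sum_sigma]
  refine Finset.sum_congr rfl fun i _ => ?_
  rw [Finset.sum_add_distrib, ← Finset.mul_sum, Finset.sum_range_id, Nat.choose_two_right,
    Finset.sum_const, Finset.card_range, smul_eq_mul]
  ring

/-- The height of each runner is its first gap. -/
theorem exists_abacusBeads_eq {t : ℕ} (ht : 0 < t) {D : Finset ℕ}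
    (hD : ∀ x, x + t ∈ D → x ∈ D) :
    ∃ l : ℕ →₀ ℕ, l.support ⊆ Finset.range t ∧ abacusBeads t l = D := by
  classical
  have hex : ∀ i, ∃ j, t * j + i ∉ D := by
    intro i
    by_contra! h
    have hinj : Function.Injective fun j => t * j + i := fun a b hab => by
      simpa [ht.ne'] using hab
    exact Set.infinite_of_injective_forall_mem hinj h D.finite_toSet
  have hanti : ∀ i j j', j ≤ j' → t * j' + i ∈ D → t * j + i ∈ D := by
    intro i j j' hj
    induction j', hj using Nat.le_induction with
    | base => exact id
    | succ k hk ih =>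
      intro h
      refine ih (hD _ ?_)
      rwa [show t * k + i + t = t * (k + 1) + i by ring]
  refine ⟨Finsupp.onFinset (Finset.range t) (fun i => if i < t then Nat.find (hex i) else 0)
    (fun i hi => by by_contra h; simp_all), Finsupp.support_onFinset_subset, ?_⟩
  ext x
  rw [mem_abacusBeads ht, Finsupp.onFinset_apply, if_pos (Nat.mod_lt x ht), Nat.lt_find_iff]
  constructor
  · intro h
    have := not_not.1 (h _ le_rfl)
    rwa [Nat.div_add_mod] at this
  · intro h m hm
    rw [not_not]
    refine hanti _ m (x / t) hm ?_
    rwa [Nat.div_add_mod]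

open Finset in
/-- The fillings of an abacus with `t` runners by `N` beads that represent partitions of `n`. -/
def coreAbaci (t N n : ℕ) : Finset (ℕ →₀ ℕ) :=
  ((range t).finsuppAntidiag N).filter
    fun l => ∑ i ∈ range t, (i * l i + t * (l i).choose 2) = N.choose 2 + n

theorem mem_coreAbaci {t N n : ℕ} {l : ℕ →₀ ℕ} : l ∈ coreAbaci t N n ↔
    l.support ⊆ Finset.range t ∧ (abacusBeads t l).card = N ∧
      ∑ x ∈ abacusBeads t l, x = N.choose 2 + n := by
  rw [coreAbaci, Finset.mem_filter, Finset.mem_finsuppAntidiag, card_abacusBeads, sum_abacusBeads]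
  tauto

/-- Cores and fillings inject onto the same family of bead sets; `n ≤ N` ensures that `N` beads
record every row. -/
theorem ncard_corePartitions {t N n : ℕ} (ht : 0 < t) (hn : n ≤ N) :
    (corePartitions t n).ncard = (coreAbaci t N n).card := by
  have hrow : ∀ μ : YoungDiagram, μ.card = n → μ.rowLen N = 0 := fun μ hμ => by
    by_contra h
    have := YoungDiagram.lt_card_of_rowLen_ne_zero h
    omega
  have h1 : ((fun μ : YoungDiagram => μ.betaSet N) '' corePartitions t n).ncard =
      (corePartitions t n).ncard :=
    ((YoungDiagram.betaSet_injOn N).mono fun μ hμ => hrow μ hμ.2).ncard_image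
  have h2 : ((fun l : ℕ →₀ ℕ => abacusBeads t l) '' (coreAbaci t N n : Set (ℕ →₀ ℕ))).ncard =
      (coreAbaci t N n).card := by
    rw [Set.InjOn.ncard_image, Set.ncard_coe_finset]
    intro l hl l' hl' h
    simp only [Finset.mem_coe, mem_coreAbaci] at hl hl' h
    ext i
    by_cases hi : i < t
    · have : ∀ j, j < l i ↔ j < l' i := fun j => by
        rw [← mul_add_mem_abacusBeads hi, ← mul_add_mem_abacusBeads hi, h]
      have h1 := this (l i)
      have h2 := this (l' i)
      omega
    · have hs : ∀ m : ℕ →₀ ℕ, m.support ⊆ Finset.range t → m i = 0 := fun m hm => by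
        by_contra h0
        exact hi (Finset.mem_range.1 (hm (Finsupp.mem_support_iff.2 h0)))
      rw [hs l hl.1, hs l' hl'.1]
  rw [← h1, ← h2]
  congr 1
  ext D
  simp only [Set.mem_image, Finset.mem_coe, mem_coreAbaci]
  constructor
  · rintro ⟨μ, ⟨hcore, hcard⟩, rfl⟩
    have hμ := hrow μ hcard
    obtain ⟨l, hl, hlD⟩ :=
      exists_abacusBeads_eq ht ((YoungDiagram.isCore_iff_betaSet hμ ht).1 hcore)
    refine ⟨l, ⟨hl, ?_, ?_⟩, hlD⟩
    · rw [hlD, YoungDiagram.card_betaSet]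
    · rw [hlD, YoungDiagram.sum_betaSet hμ, hcard]
  · rintro ⟨l, ⟨hl, hcard, hsum⟩, rfl⟩
    obtain ⟨μ, hμ, hμD⟩ := YoungDiagram.exists_betaSet_eq hcard
    refine ⟨μ, ⟨?_, ?_⟩, hμD⟩
    · rw [YoungDiagram.isCore_iff_betaSet hμ ht, hμD]
      intro x
      rw [mem_abacusBeads ht, mem_abacusBeads ht, Nat.add_div_right x ht, Nat.add_mod_right]
      omega
    · have := YoungDiagram.sum_betaSet hμ
      rw [hμD, hsum] at this
      omega

theorem choose_two_le_sum {t N : ℕ} {l : ℕ →₀ ℕ} (hl : l ∈ (Finset.range t).finsuppAntidiag N) :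
    N.choose 2 ≤ ∑ i ∈ Finset.range t, (i * l i + t * (l i).choose 2) := by
  rw [Finset.mem_finsuppAntidiag, ← card_abacusBeads] at hl
  obtain ⟨μ, hμ, hμD⟩ := YoungDiagram.exists_betaSet_eq hl.1
  rw [← sum_abacusBeads, ← hμD, YoungDiagram.sum_betaSet hμ]
  exact Nat.le_add_right _ _

/-- A partition of `n` has at most `n` nonzero rows, so the lowest `N - n` positions all hold beads,
among them `t * M + i`. -/
theorem lt_of_mem_coreAbaci {t N n M i : ℕ} {l : ℕ →₀ ℕ} (hl : l ∈ coreAbaci t N n)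
    (hN : t * (M + 1) + n ≤ N) (hi : i < t) : M < l i := by
  rw [mem_coreAbaci] at hl
  obtain ⟨-, hcard, hsum⟩ := hl
  obtain ⟨μ, hμ, hμD⟩ := YoungDiagram.exists_betaSet_eq hcard
  have hsum' := YoungDiagram.sum_betaSet hμ
  rw [hμD, hsum] at hsum'
  rw [← mul_add_mem_abacusBeads hi, ← hμD, YoungDiagram.mem_betaSet]
  rw [Nat.mul_succ] at hN
  refine ⟨N - 1 - (t * M + i), by omega, ?_⟩
  have : μ.rowLen (N - 1 - (t * M + i)) = 0 := by
    by_contra h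
    have := YoungDiagram.lt_card_of_rowLen_ne_zero h
    omega
  omega

/-! ### The generating function of cores. -/

namespace PowerSeries

/-- The generating function of the partitions with at most `N` parts. -/
noncomputable def boundedPartitionSeries (N : ℕ) : ℤ⟦X⟧ :=
  invOfUnit (∏ j ∈ Finset.range N, (1 - X ^ (j + 1))) 1

theorem prod_mul_boundedPartitionSeries (N : ℕ) :
    (∏ j ∈ Finset.range N, (1 - X ^ (j + 1))) * boundedPartitionSeries N = 1 := by
  refine mul_invOfUnit _ _ ?_
  rw [map_prod]
  simp

theorem one_sub_X_pow_succ_ne_zero (N : ℕ) : (1 - X ^ (N + 1) : ℤ⟦X⟧) ≠ 0 := fun h => by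
  simpa using congrArg constantCoeff h

theorem one_sub_mul_boundedPartitionSeries_succ (N : ℕ) :
    (1 - X ^ (N + 1)) * boundedPartitionSeries (N + 1) = boundedPartitionSeries N := by
  have h1 := prod_mul_boundedPartitionSeries N
  have h2 := prod_mul_boundedPartitionSeries (N + 1)
  rw [Finset.prod_range_succ] at h2
  linear_combination boundedPartitionSeries N * h2 -
    (1 - X ^ (N + 1)) * boundedPartitionSeries (N + 1) * h1

/-- The generating function of finite sets of natural numbers, by cardinality and sum. -/
noncomputable def finsetSeries : ℤ⟦X⟧⟦X⟧ :=
  mk fun N => X ^ N.choose 2 * boundedPartitionSeries N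

theorem coeff_eq_of_eq_one_add_X_mul_rescale {F : ℤ⟦X⟧⟦X⟧} {q : ℤ⟦X⟧}
    (h : F = (1 + X) * rescale q F) (N : ℕ) :
    (1 - q ^ (N + 1)) * coeff (N + 1) F = q ^ N * coeff N F := by
  have := congrArg (coeff (N + 1)) h
  rw [add_mul, one_mul, map_add, coeff_succ_X_mul, coeff_rescale, coeff_rescale] at this
  linear_combination this

/-- The outer variable `z` marks cardinality, the inner `q` the sum. This is the functional equation
`F(z) = (1 + z) F(qz)` of `∏ (1 + z q^m)`; with constant term 1 it determines `F`. -/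
theorem finsetSeries_eq : finsetSeries = (1 + X) * rescale X finsetSeries := by
  ext1 N
  rcases N with _ | N
  · rw [add_mul, one_mul, map_add, coeff_zero_X_mul, add_zero, coeff_rescale, pow_zero, one_mul]
  · have h := one_sub_mul_boundedPartitionSeries_succ N
    rw [add_mul, one_mul, map_add, coeff_succ_X_mul, coeff_rescale, coeff_rescale, finsetSeries,
      coeff_mk, coeff_mk, Nat.choose_succ_succ, Nat.choose_one_right, pow_add]
    linear_combination X ^ N * X ^ N.choose 2 * h

theorem eq_finsetSeries {F : ℤ⟦X⟧⟦X⟧} (h0 : coeff 0 F = 1) (h : F = (1 + X) * rescale X F) :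
    F = finsetSeries := by
  ext1 N
  induction N with
  | zero =>
    have := prod_mul_boundedPartitionSeries 0
    rw [Finset.range_zero, Finset.prod_empty, one_mul] at this
    rw [h0, finsetSeries, coeff_mk, this, Nat.choose_zero_succ, pow_zero, one_mul]
  | succ N ih =>
    refine mul_left_cancel₀ (one_sub_X_pow_succ_ne_zero N) ?_
    rw [coeff_eq_of_eq_one_add_X_mul_rescale h,
      coeff_eq_of_eq_one_add_X_mul_rescale finsetSeries_eq, ih]

/-- This is the splitting of `∏ (1 + z q^m)` by the residue of `m` modulo `t`, proved through the
functional equation: `z ↦ qz` shifts the factors cyclically. -/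
theorem prod_rescale_map_finsetSeries {t : ℕ} (ht : t ≠ 0) :
    ∏ i ∈ Finset.range t, rescale (X ^ i) (map (expand t ht : ℤ⟦X⟧ →ₐ[ℤ] ℤ⟦X⟧).toRingHom
      finsetSeries) = finsetSeries := by
  set G := map (expand t ht : ℤ⟦X⟧ →ₐ[ℤ] ℤ⟦X⟧).toRingHom finsetSeries with hG
  have hG1 : G = (1 + X) * rescale (X ^ t) G := by
    conv_lhs => rw [hG, finsetSeries_eq]
    rw [map_mul, map_add, map_one, map_X]
    congr 1
    ext1 N
    rw [coeff_map, coeff_rescale, coeff_rescale, hG, coeff_map, map_mul, map_pow]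
    congr 2
    exact expand_X t ht
  apply eq_finsetSeries
  · rw [coeff_zero_eq_constantCoeff_apply, map_prod]
    refine Finset.prod_eq_one fun i _ => ?_
    rw [← coeff_zero_eq_constantCoeff_apply, coeff_rescale, pow_zero, one_mul, hG, coeff_map]
    have := prod_mul_boundedPartitionSeries 0
    rw [Finset.range_zero, Finset.prod_empty, one_mul] at this
    rw [finsetSeries, coeff_mk, this, Nat.choose_zero_succ, pow_zero, one_mul, map_one]
  · rw [map_prod]
    have : ∀ i, rescale (X : ℤ⟦X⟧) (rescale (X ^ i) G) = rescale (X ^ (i + 1)) G := fun i => by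
      rw [rescale_rescale, ← pow_succ]
    simp only [this]
    obtain ⟨s, rfl⟩ := Nat.exists_eq_add_one_of_ne_zero ht
    rw [Finset.prod_range_succ', Finset.prod_range_succ, pow_zero, rescale_one, RingHom.id_apply]
    linear_combination (∏ i ∈ Finset.range s, rescale (X ^ (i + 1)) G) * hG1

theorem X_pow_choose_mul_boundedPartitionSeries {t : ℕ} (ht : t ≠ 0) (N : ℕ) :
    X ^ N.choose 2 * boundedPartitionSeries N =
      ∑ l ∈ (Finset.range t).finsuppAntidiag N,
        X ^ (∑ i ∈ Finset.range t, (i * l i + t * (l i).choose 2)) *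
          expand t ht (∏ i ∈ Finset.range t, boundedPartitionSeries (l i)) := by
  have := congrArg (coeff N) (prod_rescale_map_finsetSeries ht)
  rw [coeff_prod] at this
  rw [finsetSeries, coeff_mk] at this
  rw [← this]
  refine Finset.sum_congr rfl fun l _ => ?_
  rw [map_prod, ← Finset.prod_pow_eq_pow_sum, ← Finset.prod_mul_distrib]
  refine Finset.prod_congr rfl fun i _ => ?_
  rw [coeff_rescale, coeff_map, coeff_mk, map_mul, map_pow, pow_add, pow_mul, pow_mul, mul_assoc]
  congr 3
  exact expand_X t ht

theorem X_pow_dvd_boundedPartitionSeries_sub {u : ℤ⟦X⟧} (hu : pentagonalSeries ℤ * u = 1)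
    (N : ℕ) : X ^ (N + 1) ∣ boundedPartitionSeries N - u := by
  have hE : X ^ (N + 1) ∣ pentagonalSeries ℤ - ∏ j ∈ Finset.range N, (1 - X ^ (j + 1)) := by
    have hM : ∀ M, N ≤ M → X ^ (N + 1) ∣ (∏ j ∈ Finset.range M, (1 - X ^ (j + 1)) : ℤ⟦X⟧) -
        ∏ j ∈ Finset.range N, (1 - X ^ (j + 1)) := by
      intro M hM
      induction M, hM using Nat.le_induction with
      | base => simp
      | succ M hM ih =>
        rw [Finset.prod_range_succ, mul_sub, mul_one, sub_right_comm]
        exact dvd_sub ih (dvd_mul_of_dvd_right (pow_dvd_pow X (by omega)) _)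
    rw [X_pow_dvd_iff]
    intro m hm
    obtain ⟨s, hs⟩ := Filter.eventually_atTop.1 (coeff_prod_one_sub_X_pow_eventually_eq ℤ m)
    obtain ⟨M, hsM⟩ := s.exists_nat_subset_range
    have h1 := hs (Finset.range (max M N))
      (hsM.trans (Finset.range_subset_range.2 (le_max_left _ _)))
    have h2 := X_pow_dvd_iff.1 (hM (max M N) (le_max_right _ _)) m hm
    rw [map_sub] at h2 ⊢
    rw [← h1, h2]
  have h1 := prod_mul_boundedPartitionSeries N
  have : boundedPartitionSeries N - u = (pentagonalSeries ℤ -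
      ∏ j ∈ Finset.range N, (1 - X ^ (j + 1))) * (u * boundedPartitionSeries N) := by
    linear_combination u * h1 - boundedPartitionSeries N * hu
  rw [this]
  exact dvd_mul_of_dvd_left hE _

theorem X_pow_dvd_prod_sub_pow {M t : ℕ} {f : ℕ → ℤ⟦X⟧} {u : ℤ⟦X⟧}
    (h : ∀ i < t, X ^ M ∣ f i - u) : X ^ M ∣ ∏ i ∈ Finset.range t, f i - u ^ t := by
  induction t with
  | zero => simp
  | succ t ih =>
    have h1 := ih fun i hi => h i (by omega)
    have h2 := h t (by omega)
    rw [Finset.prod_range_succ, pow_succ]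
    have : (∏ i ∈ Finset.range t, f i) * f t - u ^ t * u =
        (∏ i ∈ Finset.range t, f i - u ^ t) * f t + u ^ t * (f t - u) := by ring
    rw [this]
    exact dvd_add (dvd_mul_of_dvd_left h1 _) (dvd_mul_of_dvd_right h2 _)

/-- The generating function of the `t`-core partitions. -/
noncomputable def coreSeries (t : ℕ) : ℤ⟦X⟧ := mk fun n => ((corePartitions t n).ncard : ℤ)

/-- The coefficient of `z^N` in the residue splitting tends to this identity as `N` grows: each
bounded partition series tends to `u = 1 / E`, and the sum over fillings becomes the count of cores.
-/
theorem coreSeries_mul_expand_pow {t : ℕ} (ht : t ≠ 0) {u : ℤ⟦X⟧}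
    (hu : pentagonalSeries ℤ * u = 1) : coreSeries t * expand t ht (u ^ t) = u := by
  have ht' : 0 < t := Nat.pos_of_ne_zero ht
  ext M
  -- Large enough that, for every `n ≤ M`, each runner of a filling for `n` has more than `M` beads,
  -- so truncation is invisible up to degree `M`.
  set N := t * (M + 1) + M with hN
  have hMN : M ≤ N := Nat.le_add_left _ _
  have h1 : coeff M u = coeff M (boundedPartitionSeries N) := by
    have := X_pow_dvd_iff.1 (X_pow_dvd_boundedPartitionSeries_sub hu N) M (by omega)
    rw [map_sub] at this
    omega
  rw [h1, ← coeff_X_pow_mul (boundedPartitionSeries N) (N.choose 2) M,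
    X_pow_choose_mul_boundedPartitionSeries ht, map_sum, coeff_mul,
    Finset.Nat.sum_antidiagonal_eq_sum_range_succ_mk]
  have h2 : ∀ n ∈ Finset.range (M + 1), ∀ l ∈ coreAbaci t N n,
      coeff (M + N.choose 2) (X ^ (∑ i ∈ Finset.range t, (i * l i + t * (l i).choose 2)) *
        expand t ht (∏ i ∈ Finset.range t, boundedPartitionSeries (l i))) =
      coeff (M - n) (expand t ht (u ^ t)) := by
    intro n hn l hl
    rw [Finset.mem_range] at hn
    rw [(Finset.mem_filter.1 hl).2, coeff_X_pow_mul', if_pos (by omega),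
      show M + N.choose 2 - (N.choose 2 + n) = M - n by omega, coeff_expand, coeff_expand]
    split_ifs
    · have hdvd : X ^ (M + 1) ∣ ∏ i ∈ Finset.range t, boundedPartitionSeries (l i) - u ^ t := by
        refine X_pow_dvd_prod_sub_pow fun i hi => ?_
        have := lt_of_mem_coreAbaci hl (M := M) (by omega) hi
        exact (pow_dvd_pow X (by omega)).trans (X_pow_dvd_boundedPartitionSeries_sub hu (l i))
      have := X_pow_dvd_iff.1 hdvd ((M - n) / t) (by
        have := Nat.div_le_self (M - n) t
        omega)
      rw [map_sub] at this
      omega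
    · rfl
  have h3 : ∀ n ∈ Finset.range (M + 1), coeff n (coreSeries t) * coeff (M - n)
      (expand t ht (u ^ t)) = ∑ l ∈ coreAbaci t N n,
      coeff (M + N.choose 2) (X ^ (∑ i ∈ Finset.range t, (i * l i + t * (l i).choose 2)) *
        expand t ht (∏ i ∈ Finset.range t, boundedPartitionSeries (l i))) := by
    intro n hn
    rw [Finset.sum_congr rfl (h2 n hn), Finset.sum_const, nsmul_eq_mul, coreSeries, coeff_mk,
      ncard_corePartitions ht' (N := N) (by rw [Finset.mem_range] at hn; omega)]
  rw [Finset.sum_congr rfl h3, Finset.sum_comm' (t' := (Finset.range t).finsuppAntidiag N)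
    (s' := fun l => (Finset.range (M + 1)).filter fun n =>
      ∑ i ∈ Finset.range t, (i * l i + t * (l i).choose 2) = N.choose 2 + n)]
  · refine Finset.sum_congr rfl fun l hl => ?_
    -- The exponent of a filling is at least `N.choose 2`, so each filling belongs to exactly one `n
    -- = e`, or contributes nothing when `e > M`.
    have hle := choose_two_le_sum hl
    obtain ⟨e, he⟩ := Nat.exists_eq_add_of_le hle
    rw [he, Finset.sum_const, coeff_X_pow_mul']
    split_ifs with hM
    · have : (Finset.range (M + 1)).filter (fun n => N.choose 2 + e = N.choose 2 + n) = {e} := by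
        ext n
        simp only [Finset.mem_filter, Finset.mem_range, Finset.mem_singleton]
        omega
      rw [this, Finset.card_singleton, one_smul]
    · rw [smul_zero]
  · intro n l
    simp only [coreAbaci, Finset.mem_filter]
    tauto

/-- The generating function of the `t`-cores is `∏ (1 - q ^ (t * n)) ^ t / (1 - q ^ n)`. -/
theorem coreSeries_mul_pentagonalSeries {t : ℕ} (ht : t ≠ 0) :
    coreSeries t * pentagonalSeries ℤ = expand t ht (pentagonalSeries ℤ) ^ t := by
  obtain ⟨u, hu⟩ := isUnit_pentagonalSeries.exists_right_inv
  have h1 := coreSeries_mul_expand_pow ht hu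
  have h2 : expand t ht (pentagonalSeries ℤ) ^ t * expand t ht (u ^ t) = 1 := by
    rw [map_pow, ← mul_pow, ← map_mul, hu, map_one, one_pow]
  linear_combination (-coreSeries t * pentagonalSeries ℤ) * h2 +
    expand t ht (pentagonalSeries ℤ) ^ t * pentagonalSeries ℤ * h1 +
    expand t ht (pentagonalSeries ℤ) ^ t * hu

end PowerSeries

/-! ### Tuples of cores and the congruences. -/

theorem A_eq_sum_prod (t k n : ℕ) : A t k n =
    ∑ l ∈ (Finset.univ : Finset (Fin k)).finsuppAntidiag n,
      ∏ i, (corePartitions t (l i)).ncard := by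
  classical
  have hfin : ∀ m, (corePartitions t m).Finite := fun m =>
    (YoungDiagram.finite_card_le m).subset fun μ hμ => hμ.2.le
  have hA : A t k n = (coreTuples_finite t k n).toFinset.card := by
    rw [A, Set.ncard_eq_toFinset_card _ (coreTuples_finite t k n)]
  rw [hA, Finset.card_eq_sum_card_fiberwise
    (f := fun Λ : Fin k → YoungDiagram => Finsupp.equivFunOnFinite.symm fun i => (Λ i).card)
    (t := (Finset.univ : Finset (Fin k)).finsuppAntidiag n)]
  · refine Finset.sum_congr rfl fun l hl => ?_
    rw [Finset.prod_congr rfl fun i _ => Set.ncard_eq_toFinset_card _ (hfin (l i)),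
      ← Fintype.card_piFinset]
    congr 1
    ext Λ
    rw [Finset.mem_finsuppAntidiag] at hl
    simp only [Finset.mem_filter, Set.Finite.mem_toFinset, Fintype.mem_piFinset, coreTuples,
      corePartitions, Set.mem_ofPred_eq]
    constructor
    · rintro ⟨⟨h1, h2⟩, rfl⟩ i
      exact ⟨h1 i, rfl⟩
    · intro h
      refine ⟨⟨fun i => (h i).1, ?_⟩, ?_⟩
      · rw [← hl.1]
        exact Finset.sum_congr rfl fun i _ => (h i).2
      · ext i
        exact (h i).2
  · intro Λ hΛ
    have hΛ' : Λ ∈ coreTuples t k n := by simpa using hΛ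
    rw [Finset.mem_coe, Finset.mem_finsuppAntidiag]
    exact ⟨hΛ'.2, Finset.subset_univ _⟩

theorem A_eq_coeff (t k n : ℕ) :
    (A t k n : ℤ) = PowerSeries.coeff n (PowerSeries.coreSeries t ^ k) := by
  have := PowerSeries.coeff_prod (fun _ : Fin k => PowerSeries.coreSeries t) n Finset.univ
  rw [Finset.prod_const, Finset.card_univ, Fintype.card_fin] at this
  rw [this, A_eq_sum_prod]
  push_cast
  refine Finset.sum_congr rfl fun l _ => Finset.prod_congr rfl fun i _ => ?_
  rw [PowerSeries.coreSeries, PowerSeries.coeff_mk]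

theorem theorem4 (n : ℕ) :
    A 5 2 (25 * n + 23) ≡ 0 [MOD 25] ∧
    A 5 2 (125 * n + 123) ≡ 0 [MOD 125] ∧
    A 5 3 (25 * n + 22) ≡ 0 [MOD 5] ∧
    A 5 3 (125 * n + 122) ≡ 0 [MOD 25] ∧
    A 5 4 (25 * n + 21) ≡ 0 [MOD 3125] ∧
    A 5 4 (125 * n + 121) ≡ 0 [MOD 15625] := by
  have h := PowerSeries.dvd_coeff_pow
    (PowerSeries.coreSeries_mul_pentagonalSeries (by norm_num : 5 ≠ 0)) n
  simp only [← A_eq_coeff] at h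
  simp only [Nat.modEq_zero_iff_dvd]
  exact_mod_cast h
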